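/- Let $G=(V,E)$ be a simple graph, finite or infinite (of arbitrary cardinality, not necessarily connected or locally finite), with no isolated edge, i.e. no edge that shares no endvertex with any other edge. Then there is an edge weighting $\omega\colon E\to\{1,2,3\}$ such that for every edge $uv\in E$, either $s_\omega(u)\neq s_\omega(v)$, or $u$ and $v$ have the same infinite degree. Here the degree of a vertex $v$ is the cardinality of its set of neighbours $N(v)$, and $s_\omega(v)=\sum_{w\in N(v)}\omega(vw)$ is its weighted degree; both are cardinal numbers, possibly infinite. -/

import Mathlib

universe u

namespace SimpleGraph

variable {V : Type u} (G : SimpleGraph V)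

/-- An isolated edge: an edge that shares no endvertex with any other edge of `G`, that is, a
connected component of `G` that is a single edge. -/
def IsIsolatedEdge (e : Sym2 V) : Prop :=
  e ∈ G.edgeSet ∧ ∀ f ∈ G.edgeSet, (∃ v, v ∈ e ∧ v ∈ f) → f = e

/-- The degree of a vertex, as a cardinal number. -/
noncomputable def cardinalDegree (v : V) : Cardinal.{u} :=
  Cardinal.mk (G.neighborSet v)

/-- The weighted degree of `v`: the cardinal sum, over the neighbours `w` of `v`, of the weights
of the edges `vw`. -/
noncomputable def weightedDegree (ω : G.edgeSet → ℕ) (v : V) : Cardinal.{u} :=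
  Cardinal.sum fun w : G.neighborSet v =>
    ((ω ⟨s(v, w.1), G.mem_edgeSet.2 w.2⟩ : ℕ) : Cardinal.{u})

/-- A `k`-edge weighting: all weights lie in `{1, …, k}`. -/
def IsEdgeWeighting (k : ℕ) (ω : G.edgeSet → ℕ) : Prop :=
  ∀ e, 1 ≤ ω e ∧ ω e ≤ k

/-- A `k`-weighting: a `k`-edge weighting such that the endvertices of each edge have different
weighted degrees, or have the same infinite degree. -/
def IsWeighting (k : ℕ) (ω : G.edgeSet → ℕ) : Prop :=
  G.IsEdgeWeighting k ω ∧
    ∀ u v : V, G.Adj u v →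
      G.weightedDegree ω u ≠ G.weightedDegree ω v ∨
        (G.cardinalDegree u = G.cardinalDegree v ∧ Cardinal.aleph0 ≤ G.cardinalDegree u)

end SimpleGraph

/-!
Vertices of infinite degree have their degree as weighted degree, whatever the weights, so only the
edges between vertices of finite degree carry a constraint. By compactness (Rado's selection lemma)
finitely many constraints may be considered at a time; these involve only finitely many edges, so
the theorem reduces to finite connected graphs without isolated edges.

For such a graph `G`, weights are written as `2 + ε` with `ε ∈ {-1, 0, 1}`. The vertices are split
into an independent set `B` (blue) and the red rest, such that the edges with exactly one end in
`B` form a connected graph, the crossing graph. The goal is that red vertices get odd sums and blue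
vertices even sums, which separates the colours; blue vertices are not adjacent to each other.

*Red against red.* Take a maximum cut of the red graph. Red vertices on different sides are
separated by the residues `1` and `3` modulo `4`. On the same side, the edges get values `±1` that
realise greedily chosen sums; the effect on earlier vertices is balanced by an integral flow
through the cut edges, which exists by Hoffman's theorem because a maximum cut has at every set at
least as many cut edges as edges inside the sides (`exists_perturbation_of_residues`). The flow only
needs the contributions of the crossing edges to lie in given odd classes modulo `4`, and these are
arranged by the signs on an edge set of the crossing graph that is odd exactly at the red vertices
(`exists_isTame`). Such an edge set, a `T`-join, exists if the number of red vertices is even.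

*An odd number of red vertices.* Then one red vertex `v` is made exceptional and gets an even sum,
and the only possible conflicts are those between `v` and its blue neighbours. A vertex of degree
one has too small a sum for a conflict. If the minimum degree is at least two, `B` is taken of
maximum size. The signs of the edges from `v` to blue vertices are free, and
they resolve the conflicts (`exists_star_signs`) unless `v` has exactly three neighbours, all blue
and of degree three like `v` (`isCubicAt_of_reachable`). In the latter case a second red vertex with
a blue neighbour in common with `v` provides a further free sign, provided that the removal of both
leaves the crossing graph connected (`false_of_isCubicAt`). Near the bottom of a breadth-first tree
of the crossing graph, such vertices exist (`false_of_maximum`); the obstacles there are red vertices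
with a single blue neighbour, which are controlled by exchanging an edge of a triangle
(`private_not_adj`) and by the maximality of `B` (`private_unique`).
-/

namespace SimpleGraph

open Finset Classical

/-! ### Integral flows -/

/-- The total capacity of the pairs leaving `U`. -/
noncomputable def cutCapacity {V : Type u} [Fintype V] (κ : V → V → ℤ) (U : Finset V) : ℤ :=
  ∑ a, ∑ b, if a ∈ U ∧ b ∉ U then κ a b else 0

/-- Submodularity of the cut capacity, with the gain from the pair `(u, v)`, which both `U` and `W`
separate but neither their intersection nor their union does. -/
theorem cutCapacity_inter_add_union {V : Type u} [Fintype V] (κ : V → V → ℤ)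
    (hs : ∀ a b, κ a b = κ b a) (h0 : ∀ a b, 0 ≤ κ a b) {u v : V} {U W : Finset V}
    (huU : u ∈ U) (hvU : v ∉ U) (huW : u ∉ W) (hvW : v ∈ W) :
    cutCapacity κ (U ∩ W) + cutCapacity κ (U ∪ W) + 2 * κ u v
      ≤ cutCapacity κ U + cutCapacity κ W := by
  have huv : u ≠ v := fun h => hvU (h ▸ huU)
  have e : 2 * κ u v = ∑ a, ∑ b, ((if a = u then if b = v then κ a b else 0 else 0)
      + (if a = v then if b = u then κ a b else 0 else 0)) := by
    simp only [Finset.sum_add_distrib]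
    simp [Finset.sum_ite_eq', Finset.sum_ite_irrel, hs v u]
    ring
  rw [e]
  unfold cutCapacity
  simp only [← Finset.sum_add_distrib]
  refine Finset.sum_le_sum fun a _ => Finset.sum_le_sum fun b _ => ?_
  have := h0 a b
  by_cases h1 : a = u
  · subst h1
    by_cases h2 : b = v
    · subst h2
      simp [*]
    · by_cases h3 : b ∈ U <;> by_cases h4 : b ∈ W <;> simp [*]
  · by_cases h2 : a = v
    · subst h2
      by_cases h2 : b = u
      · subst h2
        simp [*]
      · by_cases h3 : b ∈ U <;> by_cases h4 : b ∈ W <;> simp [*]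
    · by_cases h3 : a ∈ U <;> by_cases h4 : a ∈ W <;> by_cases h5 : b ∈ U <;>
        by_cases h6 : b ∈ W <;> simp [*]

/-- Integral feasible flows (Hoffman's theorem): symmetric capacities `κ` and demands `c` of total
`0` admit a flow as soon as no set demands more than the capacity of its boundary. -/
theorem exists_flow {V : Type u} [Fintype V] (κ : V → V → ℤ) (c : V → ℤ)
    (hs : ∀ a b, κ a b = κ b a) (h0 : ∀ a b, 0 ≤ κ a b) (hc : ∑ v, c v = 0)
    (hcut : ∀ U : Finset V, ∑ v ∈ U, c v ≤ cutCapacity κ U) :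
    ∃ f : V → V → ℤ, (∀ a b, f a b = - f b a) ∧ (∀ a b, |f a b| ≤ κ a b) ∧
      ∀ a, ∑ b, f a b = c a := by
  induction hn : (univ.filter fun p : V × V => p.1 ≠ p.2 ∧ κ p.1 p.2 ≠ 0).card
    using Nat.strong_induction_on generalizing κ c with
  | _ n ih =>
  by_cases hall : ∀ a b, a ≠ b → κ a b = 0
  · have hle : ∀ U : Finset V, cutCapacity κ U = 0 := fun U => by
      unfold cutCapacity
      refine Finset.sum_eq_zero fun a _ => Finset.sum_eq_zero fun b _ => ?_
      split_ifs with h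
      · exact hall a b (fun e => h.2 (e ▸ h.1))
      · rfl
    have hcle : ∀ v, c v ≤ 0 := fun v => by simpa [hle] using hcut {v}
    have hz : ∀ v, c v = 0 := fun v =>
      (Finset.sum_eq_zero_iff_of_nonpos (fun i _ => hcle i)).1 hc v (mem_univ v)
    exact ⟨fun _ _ => 0, by simp, fun a b => by simpa using h0 a b, fun a => by simp [hz]⟩
  push Not at hall
  obtain ⟨u, v, huv, hk⟩ := hall
  set k := κ u v with hkdef
  have hk0 : 0 ≤ k := h0 u v
  -- the largest amount of flow that some set forces through the pair `(u, v)`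
  obtain ⟨U₀, hU₀, hmax⟩ := Finset.exists_max_image
    (univ.filter fun U : Finset V => u ∈ U ∧ v ∉ U)
    (fun U => ∑ x ∈ U, c x - cutCapacity κ U) ⟨{u}, by simp [huv.symm]⟩
  simp only [mem_filter, mem_univ, true_and] at hU₀ hmax
  set t := max (∑ x ∈ U₀, c x - cutCapacity κ U₀ + k) (-k) with ht
  have ht1 : ∀ U : Finset V, u ∈ U → v ∉ U → ∑ x ∈ U, c x - cutCapacity κ U + k ≤ t :=
    fun U h1 h2 => le_trans (by linarith [hmax U ⟨h1, h2⟩]) (le_max_left _ _)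
  have ht2 : ∀ W : Finset V, u ∉ W → v ∈ W → ∑ x ∈ W, c x - cutCapacity κ W + k ≤ -t := by
    intro W h1 h2
    rw [ht, le_neg, max_le_iff]
    constructor
    · have := cutCapacity_inter_add_union κ hs h0 hU₀.1 hU₀.2 h1 h2
      have h3 := Finset.sum_union_inter (s₁ := U₀) (s₂ := W) (f := c)
      linarith [hcut (U₀ ∩ W), hcut (U₀ ∪ W)]
    · linarith [hcut W]
  have htk : |t| ≤ k := by
    rw [abs_le]
    refine ⟨le_max_right _ _, max_le ?_ (by linarith)⟩
    linarith [hcut U₀]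
  let κ' : V → V → ℤ := fun a b => if (a = u ∧ b = v) ∨ (a = v ∧ b = u) then 0 else κ a b
  let d : V → ℤ := fun a => (if a = u then t else 0) - (if a = v then t else 0)
  have hd : ∀ U : Finset V, ∑ x ∈ U, d x = (if u ∈ U then t else 0) - (if v ∈ U then t else 0) := by
    intro U
    simp [d, Finset.sum_sub_distrib]
  have hcap : ∀ U : Finset V, cutCapacity κ' U = cutCapacity κ U
      - (if u ∈ U ∧ v ∉ U then k else 0) - (if v ∈ U ∧ u ∉ U then k else 0) := by
    intro U
    have e1 : (if u ∈ U ∧ v ∉ U then k else 0) =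
        ∑ a, ∑ b, if a = u then if b = v then if a ∈ U ∧ b ∉ U then κ a b else 0 else 0 else 0 := by
      simp [Finset.sum_ite_irrel, hkdef]
    have e2 : (if v ∈ U ∧ u ∉ U then k else 0) =
        ∑ a, ∑ b, if a = v then if b = u then if a ∈ U ∧ b ∉ U then κ a b else 0 else 0 else 0 := by
      simp [Finset.sum_ite_irrel, hkdef, hs u v]
    rw [e1, e2]
    unfold cutCapacity
    simp only [← Finset.sum_sub_distrib]
    refine Finset.sum_congr rfl fun a _ => Finset.sum_congr rfl fun b _ => ?_
    simp only [κ']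
    by_cases h1 : a = u
    · have h2 : a ≠ v := by rw [h1]; exact huv
      by_cases h3 : b = v <;> simp [h1, h2, h3, huv]
    · by_cases h2 : a = v <;> by_cases h3 : b = u <;> simp [h1, h2, h3, huv.symm]
  obtain ⟨f, hf1, hf2, hf3⟩ := ih _ (by
      rw [← hn]
      refine Finset.card_lt_card ⟨?_, fun h => ?_⟩
      · intro p hp
        simp only [mem_filter, mem_univ, true_and, κ'] at hp ⊢
        refine ⟨hp.1, fun h => hp.2 ?_⟩
        split_ifs <;> trivial
      · have := h (show (u, v) ∈ _ by simpa using ⟨huv, hk⟩)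
        simp [κ'] at this) κ' (fun a => c a - d a)
    (fun a b => by
      simp only [κ', hs a b]
      congr 1
      simp only [eq_iff_iff]; tauto)
    (fun a b => by simp only [κ']; split_ifs; exacts [le_rfl, h0 a b])
    (by
      rw [Finset.sum_sub_distrib, hc, hd]; simp)
    (fun U => by
      rw [Finset.sum_sub_distrib, hd, hcap]
      by_cases h1 : u ∈ U <;> by_cases h2 : v ∈ U <;> simp only [h1, h2, if_true, if_false,
        not_true, not_false_iff, and_true, and_false, true_and, false_and]
      · linarith [hcut U]
      · linarith [ht1 U h1 h2]
      · linarith [ht2 U h1 h2]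
      · linarith [hcut U]) rfl
  refine ⟨fun a b => f a b + ((if a = u then if b = v then t else 0 else 0)
      - (if a = v then if b = u then t else 0 else 0)), fun a b => ?_, fun a b => ?_, fun a => ?_⟩
  · simp only [hf1 a b]
    by_cases h1 : a = u <;> by_cases h2 : a = v <;> by_cases h3 : b = u <;>
      by_cases h4 : b = v <;> simp [h1, h2, h3, h4, huv, huv.symm] <;> ring
  · have h := hf2 a b
    simp only [κ'] at h
    by_cases h1 : a = u
    · have h2 : a ≠ v := by rw [h1]; exact huv
      by_cases h3 : b = v
      · simp [h1, h3, huv] at h ⊢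
        simpa [h] using htk
      · simpa [h1, h3, huv] using (by simpa [h1, h3, huv] using h : |f u b| ≤ κ u b)
    · by_cases h2 : a = v
      · by_cases h3 : b = u
        · simp [h2, h3, huv.symm] at h ⊢
          simpa [h, hs v u] using htk
        · simpa [h1, h2, h3, huv.symm] using h
      · simpa [h1, h2] using h
  · rw [Finset.sum_add_distrib, hf3, Finset.sum_sub_distrib]
    simp [Finset.sum_ite_irrel, d]

/-! ### Residues modulo four from a maximum cut -/

/-- The degree of a vertex of a finite graph, as an integer. -/
noncomputable def intDegree {V : Type u} [Fintype V] (G : SimpleGraph V) (v : V) : ℤ :=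
  ∑ b, if G.Adj v b then 1 else 0

/-- A perturbation `ε` of the constant weighting `2`: the weights `2 + ε` lie in `{1, 2, 3}`. It is
stored as a symmetric function on pairs that vanishes off the edges. -/
structure IsPerturbation {V : Type u} (G : SimpleGraph V) (ε : V → V → ℤ) : Prop where
  symm : ∀ a b, ε a b = ε b a
  supp : ∀ a b, ¬ G.Adj a b → ε a b = 0
  le : ∀ a b, |ε a b| ≤ 1

theorem sum_antisymm {V : Type u} [Fintype V] {g : V → V → ℤ} (h : ∀ a b, g a b = - g b a) :
    ∑ a, ∑ b, g a b = 0 := by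
  have h1 : ∑ a, ∑ b, g a b = - ∑ a, ∑ b, g a b := by
    conv_lhs => rw [Finset.sum_comm]
    simp only [← Finset.sum_neg_distrib]
    exact Finset.sum_congr rfl fun a _ => Finset.sum_congr rfl fun b _ => h b a
  linarith

/-- A maximum cut: every vertex set sends at least as many edges across the cut as inside its
sides. -/
theorem exists_max_cut {V : Type u} [Fintype V] (G : SimpleGraph V) :
    ∃ s : V → ℤ, (∀ a, s a = 1 ∨ s a = -1) ∧ ∀ U : Finset V,
      ∑ a, ∑ b, (if a ∈ U ∧ b ∉ U then (if G.Adj a b then s a * s b else 0) else 0) ≤ 0 := by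
  let s : Finset V → V → ℤ := fun S a => if a ∈ S then 1 else -1
  let Q : Finset V → ℤ := fun S => ∑ a, ∑ b, if G.Adj a b then s S a * s S b else 0
  obtain ⟨S, -, hS⟩ := Finset.exists_min_image univ Q univ_nonempty
  refine ⟨s S, fun a => ?_, fun U => ?_⟩
  · by_cases h : a ∈ S <;> simp [s, h]
  have hf : ∀ a, s (symmDiff S U) a = if a ∈ U then - s S a else s S a := by
    intro a
    by_cases h1 : a ∈ S <;> by_cases h2 : a ∈ U <;> simp [s, Finset.mem_symmDiff, h1, h2]
  have h := hS (symmDiff S U) (mem_univ _)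
  set X := ∑ a, ∑ b, (if a ∈ U ∧ b ∉ U then (if G.Adj a b then s S a * s S b else 0) else 0)
    with hX
  have hX' : X = ∑ a, ∑ b,
      (if b ∈ U ∧ a ∉ U then (if G.Adj a b then s S a * s S b else 0) else 0) := by
    rw [hX, Finset.sum_comm]
    refine Finset.sum_congr rfl fun a _ => Finset.sum_congr rfl fun b _ => ?_
    simp only [G.adj_comm b a, mul_comm (s S b)]
  have key : Q (symmDiff S U) = Q S - 2 * X - 2 * X := by
    conv_rhs => rw [hX']
    conv_rhs => enter [1]; rw [← hX', hX]
    simp only [Q, Finset.mul_sum, ← Finset.sum_sub_distrib]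
    refine Finset.sum_congr rfl fun a _ => Finset.sum_congr rfl fun b _ => ?_
    rw [hf, hf]
    by_cases h1 : a ∈ U <;> by_cases h2 : b ∈ U <;> by_cases h3 : G.Adj a b <;>
      simp [h1, h2, h3] <;> ring
  linarith

theorem exists_two_mul_add_notMem (r : ℕ) (F : Finset ℤ) (hF : F.card ≤ r) (c : ℤ) :
    ∃ j : ℤ, |j| ≤ r ∧ Even ((r : ℤ) - j) ∧ c + 2 * j ∉ F := by
  have hc : ((range (r + 1)).image fun i : ℕ => c + 2 * (2 * (i : ℤ) - r)).card = r + 1 := by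
    rw [Finset.card_image_of_injective, card_range]
    intro i j h
    simp only at h
    omega
  obtain ⟨x, hx, hxF⟩ := Finset.exists_mem_notMem_of_card_lt_card (hF.trans_lt (by rw [hc]; omega))
  obtain ⟨i, hi, rfl⟩ := mem_image.1 hx
  rw [mem_range] at hi
  exact ⟨2 * (i : ℤ) - r, by rw [abs_le]; omega, ⟨r - i, by ring⟩, hxF⟩

/-- Greedy choice of shifts: each vertex `v` avoids the `#(N v)` values taken before it. -/
theorem exists_greedy_shift {V : Type u} (ρ : V → ℕ) (base : V → ℤ) (N : V → Finset V)
    (hN : ∀ v, ∀ u ∈ N v, ρ u < ρ v) :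
    ∃ j : V → ℤ, ∀ v, |j v| ≤ (N v).card ∧ Even (((N v).card : ℤ) - j v) ∧
      ∀ u ∈ N v, base u + 2 * j u ≠ base v + 2 * j v := by
  have step : ∀ (v : V) (IH : ∀ u, ρ u < ρ v → ℤ), ∃ j : ℤ, |j| ≤ (N v).card ∧
      Even (((N v).card : ℤ) - j) ∧
      base v + 2 * j ∉ (N v).attach.image fun u => base u.1 + 2 * IH u.1 (hN v u.1 u.2) :=
    fun v IH => exists_two_mul_add_notMem _ _ (card_image_le.trans (by simp)) _
  choose J hJ using step
  refine ⟨(measure ρ).wf.fix J, fun v => ?_⟩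
  have h := hJ v fun u _ => (measure ρ).wf.fix J u
  rw [WellFounded.fix_eq]
  refine ⟨h.1, h.2.1, fun u hu he => h.2.2 ?_⟩
  rw [mem_image]
  exact ⟨⟨u, hu⟩, mem_attach _ _, he⟩

/-- A sum of `#E` signs takes every value of the right size and parity. -/
theorem exists_signs_sum_eq {V : Type u} (E : Finset V) (j : ℤ) (hj : |j| ≤ E.card)
    (he : Even ((E.card : ℤ) - j)) :
    ∃ y : V → ℤ, (∀ u, |y u| ≤ 1) ∧ ∑ u ∈ E, y u = j := by
  obtain ⟨k, hk⟩ := he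
  rw [abs_le] at hj
  obtain ⟨A, hA, hAc⟩ := Finset.exists_subset_card_eq (s := E) (n := (E.card - k).toNat) (by omega)
  refine ⟨fun u => if u ∈ A then 1 else -1, fun u => by by_cases h : u ∈ A <;> simp [h], ?_⟩
  have : ∑ u ∈ E, (if u ∈ A then (1 : ℤ) else -1) = ∑ u ∈ E, ((if u ∈ A then 2 else 0) - 1) :=
    Finset.sum_congr rfl fun u _ => by split_ifs <;> norm_num
  rw [this, Finset.sum_sub_distrib, ← Finset.sum_filter, Finset.filter_mem_eq_inter,
    Finset.inter_eq_right.2 hA]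
  simp [hAc]
  omega

/-- On a finite graph, one class of odd residues modulo `4` (given by the sides of a maximum cut)
suffices: as soon as the prescribed contributions `h` from outside lie in it, the edges can be
weighted with even perturbation sums so that adjacent vertices get different totals. Edges inside
the sides realise the greedy shifts, and an integral flow across the cut balances them. -/
theorem exists_perturbation_of_residues {V : Type u} [Fintype V] (Γ : SimpleGraph V) :
    ∃ θ : V → ℤ, (∀ v, Odd (θ v)) ∧ ∀ h : V → ℤ,
      ((∀ v, (∃ u, Γ.Adj v u) → (4 : ℤ) ∣ h v - θ v) ∨
        (∀ v, (∃ u, Γ.Adj v u) → (4 : ℤ) ∣ h v - θ v - 2)) →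
      ∃ ε, Γ.IsPerturbation ε ∧ (∀ v, Even (∑ b, ε v b)) ∧ ∀ u v, Γ.Adj u v →
        h u + 2 * Γ.intDegree u + ∑ b, ε u b ≠ h v + 2 * Γ.intDegree v + ∑ b, ε v b := by
  obtain ⟨s, hs, hcut⟩ := exists_max_cut Γ
  let ρ : V → ℕ := fun v => (Fintype.equivFin V v : ℕ)
  have hρ : ∀ {a b}, ρ a = ρ b → a = b := fun {a b} h =>
    (Fintype.equivFin V).injective (Fin.ext h)
  let N : V → Finset V := fun v => univ.filter fun u => Γ.Adj v u ∧ s v = s u ∧ ρ u < ρ v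
  have hNm : ∀ v u, u ∈ N v ↔ Γ.Adj v u ∧ s v = s u ∧ ρ u < ρ v := by simp [N]
  refine ⟨fun v => 2 - s v - 2 * Γ.intDegree v - 2 * (N v).card, fun v => ?_, fun h hh => ?_⟩
  · rcases hs v with e | e
    · exact ⟨- Γ.intDegree v - (N v).card, by simp only [e]; ring⟩
    · exact ⟨1 - Γ.intDegree v - (N v).card, by simp only [e]; ring⟩
  obtain ⟨j, hj⟩ := exists_greedy_shift ρ (fun v => h v + 2 * Γ.intDegree v) N
    (fun v u hu => ((hNm v u).1 hu).2.2)
  choose y hy1 hy2 using fun v => exists_signs_sum_eq (N v) (j v) (hj v).1 (hj v).2.1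
  -- `y a b` is the sign that the later vertex `a` gives to its edge to the earlier vertex `b`;
  -- `Z` is the resulting symmetric function on the edges inside the sides, and the antisymmetric `Y`
  -- records what the cut edges have to compensate
  let Y : V → V → ℤ := fun a b =>
    if Γ.Adj a b ∧ s a = s b then (if ρ b < ρ a then y a b else - y b a) else 0
  let Z : V → V → ℤ := fun a b =>
    if Γ.Adj a b ∧ s a = s b then (if ρ b < ρ a then y a b else y b a) else 0
  let κ : V → V → ℤ := fun a b => if Γ.Adj a b ∧ s a ≠ s b then 1 else 0
  have hown : ∀ a b, (Γ.Adj a b ∧ s a = s b) ↔ (Γ.Adj b a ∧ s b = s a) := fun a b => by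
    rw [Γ.adj_comm, eq_comm (a := s a)]
  have hYa : ∀ a b, Y a b = - Y b a := by
    intro a b
    simp only [Y, hown b a]
    by_cases h1 : Γ.Adj a b ∧ s a = s b
    · rcases lt_trichotomy (ρ a) (ρ b) with h2 | h2 | h2
      · simp [h1, h2, h2.not_gt]
      · exact absurd (hρ h2) h1.1.ne
      · simp [h1, h2, h2.not_gt]
    · simp [h1]
  have hZs : ∀ a b, Z a b = Z b a := by
    intro a b
    simp only [Z, hown b a]
    by_cases h1 : Γ.Adj a b ∧ s a = s b
    · rcases lt_trichotomy (ρ a) (ρ b) with h2 | h2 | h2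
      · simp [h1, h2, h2.not_gt]
      · exact absurd (hρ h2) h1.1.ne
      · simp [h1, h2, h2.not_gt]
    · simp [h1]
  have hsY : ∀ a b, s a * Y a b = - (s b * Y b a) := by
    intro a b
    rw [hYa b a]
    by_cases h1 : s a = s b
    · rw [h1]; ring
    · simp [Y, h1]
  have hsYle : ∀ a b, s a * Y a b ≤ if Γ.Adj a b ∧ s a = s b then 1 else 0 := by
    intro a b
    have h1 := abs_le.1 (hy1 a b)
    have h2 := abs_le.1 (hy1 b a)
    simp only [Y]
    split_ifs <;> rcases hs a with e | e <;> rw [e] <;> linarith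
  obtain ⟨f, hf1, hf2, hf3⟩ := exists_flow κ (fun a => s a * ∑ b, Y a b)
    (fun a b => by simp only [κ, Γ.adj_comm a b, ne_comm (a := s a)])
    (fun a b => by simp only [κ]; split_ifs <;> norm_num)
    (by
      simp only [Finset.mul_sum]
      exact sum_antisymm hsY)
    (fun U => by
      have e1 : ∑ v ∈ U, s v * ∑ b, Y v b = ∑ a, ∑ b, (if a ∈ U ∧ b ∉ U then s a * Y a b else 0)
          + ∑ a, ∑ b, (if a ∈ U ∧ b ∈ U then s a * Y a b else 0) := by
        simp only [← Finset.sum_add_distrib, Finset.mul_sum]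
        rw [← Finset.univ_inter U, ← Finset.sum_ite_mem, Finset.univ_inter]
        refine Finset.sum_congr rfl fun a _ => ?_
        split_ifs with h1
        · refine Finset.sum_congr rfl fun b _ => ?_
          by_cases h2 : b ∈ U <;> simp [h1, h2]
        · simp [h1]
      -- the demands inside `U` cancel; those across are bounded by the maximality of the cut
      have e2 : ∑ a, ∑ b, (if a ∈ U ∧ b ∈ U then s a * Y a b else 0) = 0 := by
        refine sum_antisymm fun a b => ?_
        rw [hsY a b]
        by_cases h1 : a ∈ U <;> by_cases h2 : b ∈ U <;> simp [h1, h2]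
      rw [e1, e2, add_zero]
      have e3 := hcut U
      have e4 : ∑ a, ∑ b, (if a ∈ U ∧ b ∉ U then s a * Y a b else 0) ≤ cutCapacity κ U
          + ∑ a, ∑ b, (if a ∈ U ∧ b ∉ U then (if Γ.Adj a b then s a * s b else 0) else 0) := by
        unfold cutCapacity
        simp only [← Finset.sum_add_distrib]
        refine Finset.sum_le_sum fun a _ => Finset.sum_le_sum fun b _ => ?_
        by_cases h1 : a ∈ U ∧ b ∉ U
        · have h2 := hsYle a b
          rw [if_pos h1, if_pos h1, if_pos h1]
          by_cases h3 : Γ.Adj a b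
          · rcases hs a with e | e <;> rcases hs b with e' | e' <;> simp [κ, h3, e, e'] at h2 ⊢ <;>
              linarith
          · simpa [κ, h3] using h2
        · simp [h1]
      linarith)
  have hss : ∀ a, s a * s a = 1 := fun a => by rcases hs a with e | e <;> rw [e] <;> norm_num
  have hsum : ∀ a, ∑ b, (Z a b + s a * f a b) = 2 * j a := by
    intro a
    rw [Finset.sum_add_distrib, ← Finset.mul_sum, hf3, ← mul_assoc, hss, one_mul,
      ← Finset.sum_add_distrib, ← hy2, Finset.mul_sum, Finset.sum_filter]
    refine Finset.sum_congr rfl fun b _ => ?_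
    simp only [Y, Z]
    by_cases h1 : Γ.Adj a b <;> by_cases h2 : s a = s b <;> by_cases h3 : ρ b < ρ a <;>
      simp [h1, h2, h3] <;> ring
  refine ⟨fun a b => Z a b + s a * f a b, ⟨fun a b => ?_, fun a b hab => ?_, fun a b => ?_⟩,
    fun v => ?_, fun u v huv => ?_⟩
  · simp only [hZs a b, hf1 a b]
    by_cases h1 : s a = s b
    · have := hf2 b a
      simp [κ, h1] at this
      simp [this]
    · rcases hs a with e | e <;> rcases hs b with e' | e' <;> simp [e, e'] at h1 ⊢
  · have := hf2 a b
    simp [κ, hab] at this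
    simp [Z, hab, this]
  · have h0 := hf2 a b
    by_cases h1 : Γ.Adj a b ∧ s a = s b
    · simp [κ, h1] at h0
      have h2 := hy1 a b
      have h3 := hy1 b a
      simp only [Z, h0, if_pos h1, mul_zero, add_zero]
      split_ifs <;> assumption
    · have h2 : |f a b| ≤ 1 := h0.trans (by simp only [κ]; split_ifs <;> norm_num)
      simp only [Z, h1, if_false, zero_add, abs_mul]
      rcases hs a with e | e <;> simpa [e] using h2
  · rw [hsum]; exact even_two_mul _
  · rw [hsum, hsum]
    by_cases h1 : s u = s v
    · rcases lt_trichotomy (ρ u) (ρ v) with h2 | h2 | h2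
      · exact (hj v).2.2 u ((hNm v u).2 ⟨huv.symm, h1.symm, h2⟩)
      · exact absurd (hρ h2) huv.ne
      · exact ((hj u).2.2 v ((hNm u v).2 ⟨huv, h1, h2⟩)).symm
    -- across the cut the totals are `1` and `3` modulo `4`, up to a common shift
    · intro he
      obtain ⟨k, hk⟩ := (hj u).2.1
      obtain ⟨l, hl⟩ := (hj v).2.1
      rcases hh with hh | hh <;> have hu := hh u ⟨v, huv⟩ <;> have hv := hh v ⟨u, huv.symm⟩ <;>
        rcases hs u with e | e <;> rcases hs v with e' | e' <;> 
        simp only [e, e'] at hu hv h1 he hk hl <;>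
        first
          | exact h1 trivial
          | omega

/-! ### Joins, signs and tame perturbations -/

/-- The edge weighting `2 + ε` distinguishes adjacent vertices, for some perturbation `ε`. -/
def HasGoodPerturbation {V : Type u} [Fintype V] (G : SimpleGraph V) : Prop :=
  ∃ ε, G.IsPerturbation ε ∧ ∀ u v, G.Adj u v →
    2 * G.intDegree u + ∑ b, ε u b ≠ 2 * G.intDegree v + ∑ b, ε v b

/-- The symmetric function on pairs with value `t` on the pair `{a, b}` and `0` elsewhere. -/
noncomputable def edgeFun {V : Type u} {M : Type*} [Zero M] (a b : V) (t : M) : V → V → M :=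
  fun p q => if (p = a ∧ q = b) ∨ (p = b ∧ q = a) then t else 0

theorem edgeFun_symm {V : Type u} {M : Type*} [Zero M] (a b : V) (t : M) (p q : V) :
    edgeFun a b t p q = edgeFun a b t q p := by
  unfold edgeFun
  congr 1
  simp only [eq_iff_iff]
  tauto

theorem sum_edgeFun {V : Type u} [Fintype V] {M : Type*} [AddCommMonoid M] {a b : V} (h : a ≠ b)
    (t : M) (p : V) :
    ∑ q, edgeFun a b t p q = (if p = a then t else 0) + (if p = b then t else 0) := by
  unfold edgeFun
  by_cases h1 : p = a
  · subst h1; simp [h]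
  · by_cases h2 : p = b
    · subst h2; simp [h1]
    · simp [h1, h2]

/-- The symmetric function on pairs with value `σ q` on `{v, q}` and `0` on pairs avoiding `v`. -/
noncomputable def starFun {V : Type u} (v : V) (σ : V → ℤ) : V → V → ℤ :=
  fun p q => if p = v then σ q else if q = v then σ p else 0

theorem starFun_symm {V : Type u} (v : V) (σ : V → ℤ) (p q : V) :
    starFun v σ p q = starFun v σ q p := by
  unfold starFun
  by_cases h1 : p = v <;> by_cases h2 : q = v <;> simp [h1, h2]

theorem sum_starFun_self {V : Type u} [Fintype V] (v : V) (σ : V → ℤ) :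
    ∑ q, starFun v σ v q = ∑ q, σ q := by
  simp [starFun]

theorem sum_starFun_of_ne {V : Type u} [Fintype V] {v p : V} (σ : V → ℤ) (h : p ≠ v) :
    ∑ q, starFun v σ p q = σ p := by
  simp [starFun, h]

theorem exists_path_join {V : Type u} [Fintype V] {H : SimpleGraph V} {a r : V}
    (h : H.Reachable a r) :
    ∃ x : V → V → ZMod 2, (∀ p q, x p q = x q p) ∧ (∀ p q, ¬ H.Adj p q → x p q = 0) ∧
      ∀ p, ∑ q, x p q = (if p = a then 1 else 0) + (if p = r then 1 else 0) := by
  obtain ⟨w⟩ := h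
  induction w with
  | nil => exact ⟨fun _ _ => 0, by simp, by simp, fun p => by
      rw [Finset.sum_const_zero]; split_ifs <;> decide⟩
  | @cons a b c hab _ ih =>
    obtain ⟨x, hx1, hx2, hx3⟩ := ih
    refine ⟨fun p q => edgeFun a b 1 p q + x p q, fun p q => ?_, fun p q hpq => ?_, fun p => ?_⟩
    · exact congrArg₂ (· + ·) (edgeFun_symm a b 1 p q) (hx1 p q)
    · simp only [hx2 p q hpq]
      rw [edgeFun, if_neg, add_zero]
      rintro (⟨rfl, rfl⟩ | ⟨rfl, rfl⟩)
      exacts [hpq hab, hpq hab.symm]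
    · rw [Finset.sum_add_distrib, hx3, sum_edgeFun hab.ne]
      generalize (if p = a then (1 : ZMod 2) else 0) = i
      generalize (if p = b then (1 : ZMod 2) else 0) = j
      generalize (if p = c then (1 : ZMod 2) else 0) = k
      revert i j k
      decide

/-- `T`-joins: an even set of vertices in one component is the set of odd vertices of an edge
set. -/
theorem exists_join {V : Type u} [Fintype V] (H : SimpleGraph V) (r : V) (τ : V → ZMod 2)
    (hr : ∀ a, τ a ≠ 0 → H.Reachable a r) (hs : ∑ a, τ a = 0) :
    ∃ x : V → V → ZMod 2, (∀ p q, x p q = x q p) ∧ (∀ p q, ¬ H.Adj p q → x p q = 0) ∧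
      ∀ p, ∑ q, x p q = τ p := by
  have h : ∀ a, ∃ x : V → V → ZMod 2, (∀ p q, x p q = x q p) ∧
      (∀ p q, ¬ H.Adj p q → x p q = 0) ∧
      (τ a ≠ 0 → ∀ p, ∑ q, x p q = (if p = a then 1 else 0) + (if p = r then 1 else 0)) := by
    intro a
    by_cases ha : τ a = 0
    · exact ⟨fun _ _ => 0, by simp, by simp, fun h => absurd ha h⟩
    · obtain ⟨x, h1, h2, h3⟩ := exists_path_join (hr a ha)
      exact ⟨x, h1, h2, fun _ => h3⟩
  choose x h1 h2 h3 using h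
  refine ⟨fun p q => ∑ a, τ a * x a p q, fun p q => ?_, fun p q hpq => ?_, fun p => ?_⟩
  · simp only [h1 _ p q]
  · simp [h2 _ p q hpq]
  · rw [Finset.sum_comm]
    simp only [← Finset.mul_sum]
    have : ∀ a, τ a * ∑ q, x a p q = (if p = a then τ a else 0) + τ a * (if p = r then 1 else 0) := by
      intro a
      by_cases ha : τ a = 0
      · simp [ha]
      · rw [h3 a ha p, mul_add, mul_ite, mul_one, mul_zero]
    simp only [this, Finset.sum_add_distrib, ← Finset.sum_mul, hs]
    simp

/-- The subgraph of the edges with both ends in `Rd`, as a graph on all vertices. -/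
def within {V : Type u} (G : SimpleGraph V) (Rd : Set V) : SimpleGraph V where
  Adj a b := G.Adj a b ∧ a ∈ Rd ∧ b ∈ Rd
  symm := ⟨fun _ _ h => ⟨h.1.symm, h.2.2, h.2.1⟩⟩
  loopless := ⟨fun _ h => h.1.ne rfl⟩

/-- `ε` is a perturbation of the edges that are not inside `Rd`, with odd sums on `Rd`, and
prescribed residues modulo `4` at the vertices of `Rd` that have neighbours in `Rd`. The residues
may all be replaced by their negatives. -/
structure IsTame {V : Type u} [Fintype V] (G : SimpleGraph V) (Rd : Set V) (θ : V → ℤ)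
    (ε : V → V → ℤ) : Prop extends G.IsPerturbation ε where
  zero : ∀ a ∈ Rd, ∀ b ∈ Rd, ε a b = 0
  odd : ∀ a ∈ Rd, Odd (∑ b, ε a b)
  residue : (∀ a ∈ Rd, (∃ b ∈ Rd, G.Adj a b) → (4 : ℤ) ∣ ∑ b, ε a b - θ a) ∨
    (∀ a ∈ Rd, (∃ b ∈ Rd, G.Adj a b) → (4 : ℤ) ∣ ∑ b, ε a b + θ a)

/-- For suitable odd residues, a tame perturbation with even sums off `Rd` extends to a good one
unless two adjacent vertices off `Rd` are in conflict. -/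
theorem exists_residues {V : Type u} [Fintype V] (G : SimpleGraph V) (Rd : Set V) :
    ∃ θ : V → ℤ, (∀ v, Odd (θ v)) ∧ ∀ ε, G.IsTame Rd θ ε → (∀ a ∉ Rd, Even (∑ b, ε a b)) →
      (∀ a ∉ Rd, ∀ b ∉ Rd, G.Adj a b →
        2 * G.intDegree a + ∑ c, ε a c ≠ 2 * G.intDegree b + ∑ c, ε b c) →
      G.HasGoodPerturbation := by
  obtain ⟨θ, hθ, H⟩ := exists_perturbation_of_residues (G.within Rd)
  let n : V → ℤ := fun v => G.intDegree v - (G.within Rd).intDegree v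
  refine ⟨fun v => θ v - 2 * n v, fun v => (hθ v).sub_even (even_two_mul _),
    fun ε hε heven hne => ?_⟩
  obtain ⟨δ, hδ, hδe, hδne⟩ := H (fun v => 2 * n v + ∑ b, ε v b) (by
    rcases hε.residue with h | h
    · refine Or.inl fun v ⟨w, hw⟩ => ?_
      have := h v hw.2.1 ⟨w, hw.2.2, hw.1⟩
      omega
    · refine Or.inr fun v ⟨w, hw⟩ => ?_
      have := h v hw.2.1 ⟨w, hw.2.2, hw.1⟩
      obtain ⟨k, hk⟩ := hθ v
      omega)
  refine ⟨fun a b => ε a b + δ a b, ⟨fun a b => ?_, fun a b hab => ?_, fun a b => ?_⟩,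
    fun a b hab => ?_⟩
  · rw [hε.symm, hδ.symm]
  · rw [hε.supp a b hab, hδ.supp a b fun h => hab h.1, add_zero]
  · by_cases h : a ∈ Rd ∧ b ∈ Rd
    · rw [hε.zero a h.1 b h.2, zero_add]; exact hδ.le a b
    · rw [hδ.supp a b fun h' => h h'.2, add_zero]; exact hε.le a b
  have hz : ∀ a ∉ Rd, ∑ c, δ a c = 0 := fun a ha =>
    Finset.sum_eq_zero fun c _ => hδ.supp a c fun h => ha h.2.1
  simp only [Finset.sum_add_distrib]
  by_cases ha : a ∈ Rd <;> by_cases hb : b ∈ Rd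
  · have := hδne a b ⟨hab, ha, hb⟩
    simp only [n] at this
    intro h
    apply this
    linarith
  · have h1 := hε.odd a ha
    have h2 := heven b hb
    obtain ⟨k, hk⟩ := hδe a
    rw [hz b hb]
    obtain ⟨l, hl⟩ := h1
    obtain ⟨m, hm⟩ := h2
    omega
  · have h1 := hε.odd b hb
    have h2 := heven a ha
    obtain ⟨k, hk⟩ := hδe b
    rw [hz a ha]
    obtain ⟨l, hl⟩ := h1
    obtain ⟨m, hm⟩ := h2
    omega
  · rw [hz a ha, hz b hb, add_zero, add_zero]
    exact hne a ha b hb hab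

theorem intCast_zmod_two_eq_zero {n : ℤ} : (n : ZMod 2) = 0 ↔ Even n := by
  rw [ZMod.intCast_zmod_eq_zero_iff_dvd, even_iff_two_dvd]; rfl

theorem intCast_zmod_two_eq_one {n : ℤ} : (n : ZMod 2) = 1 ↔ Odd n := by
  rw [← Int.not_even_iff_odd, ← intCast_zmod_two_eq_zero]
  generalize (n : ZMod 2) = x
  revert x; decide

/-- An edge set that is odd at the vertices of `Rd` and has no edge inside `Rd` carries signs with
prescribed odd residues modulo `4`: each vertex of `Rd` adjusts its residue by one edge of its
own. -/
theorem exists_isTame {V : Type u} [Fintype V] (G : SimpleGraph V) (Rd : Set V) {θ : V → ℤ}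
    (hθ : ∀ v, Odd (θ v)) (x : V → V → ZMod 2) (hs : ∀ p q, x p q = x q p)
    (hsupp : ∀ p q, ¬ G.Adj p q → x p q = 0) (hRd : ∀ p ∈ Rd, ∀ q ∈ Rd, x p q = 0)
    (hodd : ∀ p ∈ Rd, ∑ q, x p q = 1) :
    ∃ ε, G.IsTame Rd θ ε ∧ ∀ p q, (ε p q : ZMod 2) = x p q := by
  let e : V → V → ℤ := fun p q => if x p q = 0 then 0 else 1
  have hex : ∀ p q, (e p q : ZMod 2) = x p q := by
    intro p q
    simp only [e]
    generalize x p q = y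
    revert y; decide
  have hpiv : ∀ p, ∃ q, p ∈ Rd → x p q ≠ 0 := by
    intro p
    by_cases hp : p ∈ Rd
    · have : ∑ q, x p q ≠ 0 := by rw [hodd p hp]; decide
      obtain ⟨q, -, hq⟩ := Finset.exists_ne_zero_of_sum_ne_zero this
      exact ⟨q, fun _ => hq⟩
    · exact ⟨p, fun h => absurd h hp⟩
  choose piv hpiv using hpiv
  have hpivR : ∀ p ∈ Rd, piv p ∉ Rd := fun p hp hq => hpiv p hp (hRd p hp _ hq)
  -- the vertices whose residue is wrong flip the sign of their pivot edge; as pivots end outside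
  -- `Rd`, no other vertex of `Rd` is affected
  let Fl : V → Prop := fun p => p ∈ Rd ∧ ¬ (4 : ℤ) ∣ ∑ q, e p q - θ p
  let ε : V → V → ℤ := fun p q =>
    if (Fl p ∧ q = piv p) ∨ (Fl q ∧ p = piv q) then - e p q else e p q
  have hεx : ∀ p q, (ε p q : ZMod 2) = x p q := by
    intro p q
    rw [← hex]
    simp only [ε]
    split_ifs
    · rw [Int.cast_neg, ZMod.neg_eq_self_mod_two]
    · rfl
  have hodd' : ∀ a ∈ Rd, Odd (∑ b, ε a b) := fun a ha => by
    rw [← intCast_zmod_two_eq_one, Int.cast_sum, ← hodd a ha]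
    exact Finset.sum_congr rfl fun b _ => hεx a b
  have he0 : ∀ p q, x p q = 0 → ε p q = 0 := fun p q h => by
    simp [ε, e, h]
  refine ⟨ε, ⟨⟨fun a b => ?_, fun a b hab => he0 a b (hsupp a b hab), fun a b => ?_⟩,
    fun a ha b hb => he0 a b (hRd a ha b hb), hodd', Or.inl fun a ha _ => ?_⟩, hεx⟩
  · simp only [ε, e, hs a b, or_comm]
  · simp only [ε, e]
    split_ifs <;> simp
  · have h2 : ∀ b, ε a b = e a b - if b = piv a then (if Fl a then 2 else 0) else 0 := by
      intro b
      have : ¬ (Fl b ∧ a = piv b) := fun h => hpivR b h.1.1 (h.2 ▸ ha)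
      simp only [ε, this, or_false]
      by_cases hF : Fl a <;> by_cases hb : b = piv a <;> simp [hF, hb]
      simp [e, hpiv a ha]
    have h3 := hodd' a ha
    rw [Finset.sum_congr rfl fun b _ => h2 b, Finset.sum_sub_distrib] at h3 ⊢
    simp only [Finset.sum_ite_eq', Finset.mem_univ, if_true] at h3 ⊢
    obtain ⟨k, hk⟩ := h3
    obtain ⟨l, hl⟩ := hθ a
    by_cases hF : Fl a
    · simp only [hF, if_true] at hk ⊢
      have := hF.2
      omega
    · have : (4 : ℤ) ∣ ∑ q, e a q - θ a := by
        by_contra h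
        exact hF ⟨ha, h⟩
      simpa [hF] using this

theorem IsTame.neg {V : Type u} [Fintype V] {G : SimpleGraph V} {Rd : Set V} {θ : V → ℤ}
    {ε : V → V → ℤ} (h : G.IsTame Rd θ ε) : G.IsTame Rd θ fun a b => - ε a b where
  symm a b := by rw [h.symm]
  supp a b hab := by rw [h.supp a b hab, neg_zero]
  le a b := by rw [abs_neg]; exact h.le a b
  zero a ha b hb := by rw [h.zero a ha b hb, neg_zero]
  odd a ha := by rw [Finset.sum_neg_distrib]; exact (h.odd a ha).neg
  residue := by
    simp only [Finset.sum_neg_distrib]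
    refine h.residue.symm.imp (fun H a ha hb => ?_) (fun H a ha hb => ?_) <;>
      have := H a ha hb <;> omega

/-- Changes that keep the sums on `Rd`, except at vertices without neighbours in `Rd`, preserve
tameness. -/
theorem IsTame.modify {V : Type u} [Fintype V] {G : SimpleGraph V} {Rd : Set V} {θ : V → ℤ}
    {ε δ : V → V → ℤ} (h : G.IsTame Rd θ ε) (hδ : G.IsPerturbation δ)
    (hz : ∀ a ∈ Rd, ∀ b ∈ Rd, δ a b = 0)
    (hE : ∀ a ∈ Rd, ∑ b, δ a b = ∑ b, ε a b ∨
      ((∀ b ∈ Rd, ¬ G.Adj a b) ∧ Odd (∑ b, δ a b))) : G.IsTame Rd θ δ where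
  symm := hδ.symm
  supp := hδ.supp
  le := hδ.le
  zero := hz
  odd a ha := by
    rcases hE a ha with h1 | h1
    · rw [h1]; exact h.odd a ha
    · exact h1.2
  residue := by
    refine h.residue.imp (fun H a ha => ?_) (fun H a ha => ?_) <;> rintro ⟨b, hb, hab⟩ <;>
      rcases hE a ha with h1 | h1
    · rw [h1]; exact H a ha ⟨b, hb, hab⟩
    · exact absurd hab (h1.1 b hb)
    · rw [h1]; exact H a ha ⟨b, hb, hab⟩
    · exact absurd hab (h1.1 b hb)

/-! ### Signs on a star -/

/-- An index `p` that nothing forbids makes `p` or `p + 1` admissible, for otherwise its two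
neighbours would have too large counts. -/
theorem exists_index_of_eq_zero {k p : ℤ} {a : ℤ → ℤ}
    (hs : ∀ I : Finset ℤ, ∑ i ∈ I, a i ≤ k) (hp0 : 0 ≤ p) (hpk : p < k) (hp : a p = 0) :
    (a p ≤ p ∧ a (p - 1) ≤ k - p) ∨ (a (p + 1) ≤ p + 1 ∧ a (p + 1 - 1) ≤ k - (p + 1)) := by
  have h1 := hs {p - 1, p + 1}
  rw [Finset.sum_pair (by omega)] at h1
  have h2 : p + 1 - 1 = p := by ring
  rw [h2]
  omega

theorem sum_sub_one_le {k : ℤ} {a : ℤ → ℤ} (hs : ∀ I : Finset ℤ, ∑ i ∈ I, a i ≤ k)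
    {Z I : Finset ℤ} (hZ : Z ⊆ Ico 0 k) (hk : 0 ≤ k) (hI : I ⊆ Ico 0 k \ Z)
    (h1 : ∀ i ∈ Ico 0 k \ Z, 1 ≤ a i) : ∑ i ∈ I, (a i - 1) ≤ Z.card := by
  have h2 : ∑ i ∈ I, (a i - 1) ≤ ∑ i ∈ Ico 0 k \ Z, (a i - 1) :=
    Finset.sum_le_sum_of_subset_of_nonneg hI fun i hi _ => by linarith [h1 i hi]
  have h3 := hs (Ico 0 k \ Z)
  have h4 : ((Ico 0 k \ Z).card : ℤ) = k - Z.card := by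
    have := Finset.card_sdiff_add_card_eq_card hZ
    rw [Int.card_Ico] at this
    omega
  rw [Finset.sum_sub_distrib] at h2
  simp only [Finset.sum_const, nsmul_eq_mul, mul_one] at h2
  rw [Finset.sum_sub_distrib] at h2
  simp only [Finset.sum_const, nsmul_eq_mul, mul_one] at h2
  rw [Finset.sum_sub_distrib]
  simp only [Finset.sum_const, nsmul_eq_mul, mul_one]
  linarith

/-- The counting behind the choice of signs on a star of `k` edges: `a i` counts the leaves that
forbid the value `i`. -/
theorem exists_index {k : ℤ} {a : ℤ → ℤ} (h0 : ∀ i, 0 ≤ a i)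
    (hs : ∀ I : Finset ℤ, ∑ i ∈ I, a i ≤ k) (hk : 2 ≤ k) :
    ∃ j, 0 ≤ j ∧ j ≤ k ∧ a j ≤ j ∧ a (j - 1) ≤ k - j := by
  by_cases hz : ∃ p, 0 ≤ p ∧ p < k ∧ a p = 0
  · obtain ⟨p, hp0, hpk, hp⟩ := hz
    rcases exists_index_of_eq_zero hs hp0 hpk hp with h | h
    · exact ⟨p, hp0, hpk.le, h⟩
    · exact ⟨p + 1, by omega, by omega, h⟩
  · push Not at hz
    have h1 : ∀ i ∈ Ico 0 k \ ∅, 1 ≤ a i := fun i hi => by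
      simp at hi
      have := hz i hi.1 hi.2
      have := h0 i
      omega
    have h2 := sum_sub_one_le hs (Z := ∅) (I := {0}) (by simp) (by omega) (by simp; omega) h1
    have h3 := sum_sub_one_le hs (Z := ∅) (I := {1}) (by simp) (by omega) (by simp; omega) h1
    simp at h2 h3
    exact ⟨1, by omega, by omega, by omega, by norm_num; omega⟩

/-- For `k ≥ 4` there is an admissible index other than a given one. -/
theorem exists_index_ne {k : ℤ} {a : ℤ → ℤ} (h0 : ∀ i, 0 ≤ a i)
    (hs : ∀ I : Finset ℤ, ∑ i ∈ I, a i ≤ k) (hk : 4 ≤ k) (j₀ : ℤ) :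
    ∃ j, j ≠ j₀ ∧ 0 ≤ j ∧ j ≤ k ∧ a j ≤ j ∧ a (j - 1) ≤ k - j := by
  by_contra hno
  push Not at hno
  have bad : ∀ j, j ≠ j₀ → 0 ≤ j → j ≤ k → a j ≤ j → a (j - 1) ≤ k - j → False :=
    fun j h1 h2 h3 h4 h5 => absurd (hno j h1 h2 h3 h4) (by omega)
  -- an index with `a p = 0` makes `p` or `p + 1` good, so it is next to `j₀`
  have hzero : ∀ p, 0 ≤ p → p < k → a p = 0 →
      (p = j₀ ∧ p + 2 ≤ a (p + 1)) ∨ (p + 1 = j₀ ∧ k - p + 1 ≤ a (p - 1)) := by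
    intro p hp0 hpk hp
    have e : p + 1 - 1 = p := by ring
    have b1 : p ≠ j₀ → ¬ a (p - 1) ≤ k - p := fun h1 h2 =>
      bad p h1 hp0 hpk.le (by omega) h2
    have b2 : p + 1 ≠ j₀ → ¬ a (p + 1) ≤ p + 1 := fun h1 h2 =>
      bad (p + 1) h1 (by omega) (by omega) h2 (by rw [e]; omega)
    have h3 := exists_index_of_eq_zero hs hp0 hpk hp
    omega
  have hpos : ∀ Z : Finset ℤ, (∀ p, 0 ≤ p → p < k → a p = 0 → p ∈ Z) →
      ∀ i ∈ Ico 0 k \ Z, 1 ≤ a i := fun Z hZ i hi => by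
    simp only [Finset.mem_sdiff, Finset.mem_Ico] at hi
    have : a i ≠ 0 := fun h => hi.2 (hZ i hi.1.1 hi.1.2 h)
    have := h0 i
    omega
  by_cases hz : ∃ p, 0 ≤ p ∧ p < k ∧ a p = 0
  · obtain ⟨p, hp0, hpk, hp⟩ := hz
    by_cases huniq : ∀ q, 0 ≤ q → q < k → a q = 0 → q ∈ ({p} : Finset ℤ)
    · have hle := fun I hI => sum_sub_one_le hs (Z := {p}) (I := I) (by simp; omega) (by omega) hI
        (hpos _ huniq)
      rcases hzero p hp0 hpk hp with ⟨h1, h2⟩ | ⟨h1, h2⟩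
      · have h3 := hs {p + 1}
        rw [Finset.sum_singleton] at h3
        have h4 := hle {p + 1} (by simp; omega)
        simp only [Finset.sum_singleton, Finset.card_singleton] at h4
        have hp' : p = 0 := by omega
        subst hp'
        have h5 := hle {1, 2} (by
          intro i; simp only [Finset.mem_insert, Finset.mem_singleton, Finset.mem_sdiff,
            Finset.mem_Ico]; omega)
        rw [Finset.sum_pair (by norm_num), Finset.card_singleton] at h5
        norm_num at h2 h4
        exact bad 2 (by omega) (by omega) (by omega) (by omega) (by norm_num; omega)
      · have h3 := hs {p - 1}
        rw [Finset.sum_singleton] at h3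
        have h4 := hle {p - 1} (by simp; omega)
        simp only [Finset.sum_singleton, Finset.card_singleton] at h4
        have hp' : p = k - 1 := by omega
        subst hp'
        have e1 : k - 1 - 1 = k - 2 := by ring
        rw [e1] at h2 h4
        have h5 := hle {k - 2, k - 3} (by
          intro i; simp only [Finset.mem_insert, Finset.mem_singleton, Finset.mem_sdiff,
            Finset.mem_Ico]; omega)
        rw [Finset.sum_pair (by omega), Finset.card_singleton] at h5
        have e2 : k - 2 - 1 = k - 3 := by ring
        exact bad (k - 2) (by omega) (by omega) (by omega) (by omega) (by rw [e2]; omega)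
    · push Not at huniq
      obtain ⟨q, hq0, hqk, hq, hqp⟩ := huniq
      rw [Finset.mem_singleton] at hqp
      have hcontra : ∀ p, p + 1 + 2 ≤ a (p + 1 + 1) → k - p + 1 ≤ a (p - 1) → 0 ≤ p →
          False := by
        intro p h1 h2 h3
        have h4 := hs {p + 1 + 1, p - 1}
        rw [Finset.sum_pair (by omega)] at h4
        omega
      rcases hzero p hp0 hpk hp with ⟨h1, h2⟩ | ⟨h1, h2⟩ <;>
        rcases hzero q hq0 hqk hq with ⟨h3, h4⟩ | ⟨h3, h4⟩
      · omega
      · have : p = q + 1 := by omega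
        subst this
        exact hcontra q h2 h4 hq0
      · have : q = p + 1 := by omega
        subst this
        exact hcontra p h4 h2 hp0
      · omega
  · push Not at hz
    have hle := fun I hI => sum_sub_one_le hs (Z := ∅) (I := I) (by simp) (by omega) hI
        (hpos ∅ fun p h1 h2 h3 => absurd h3 (hz p h1 h2))
    have h2 := hle {0} (by simp; omega)
    have h3 := hle {1} (by simp; omega)
    have h4 := hle {2} (by simp; omega)
    simp at h2 h3 h4
    by_cases h : j₀ = 1
    · exact bad 2 (by omega) (by omega) (by omega) (by omega) (by norm_num; omega)
    · exact bad 1 (by omega) (by omega) (by omega) (by omega) (by norm_num; omega)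

/-- If `j` of the `#K` signs are positive, the total at the centre is `2j - #K`. The leaves for which
a negative sign is forbidden have to be among the positive ones, those for which a positive sign is
forbidden must not. -/
theorem exists_star_signs_of_index {V : Type u} (K : Finset V) (g : V → ℤ) {j : ℤ} (hj0 : 0 ≤ j)
    (hjk : j ≤ K.card) (h1 : ((K.filter fun b => g b = 2 * j - K.card + 1).card : ℤ) ≤ j)
    (h2 : ((K.filter fun b => g b = 2 * (j - 1) - K.card + 1).card : ℤ) ≤ K.card - j) :
    ∃ σ : V → ℤ, (∀ b ∈ K, σ b = 1 ∨ σ b = -1) ∧ ∑ b ∈ K, σ b = 2 * j - K.card ∧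
      ∀ b ∈ K, ∑ c ∈ K, σ c - σ b ≠ g b := by
  have hsub : (K.filter fun b => g b = 2 * j - K.card + 1) ⊆
      K \ (K.filter fun b => g b = 2 * (j - 1) - K.card + 1) := by
    intro b
    simp only [Finset.mem_filter, Finset.mem_sdiff]
    rintro ⟨hb, h⟩
    refine ⟨hb, fun h' => ?_⟩
    have := h'.2
    omega
  have hcard := Finset.card_sdiff_add_card_eq_card
    (Finset.filter_subset (fun b => g b = 2 * (j - 1) - K.card + 1) K)
  obtain ⟨X, hX1, hX2, hXc⟩ := Finset.exists_subsuperset_card_eq hsub (n := j.toNat)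
    (by omega) (by omega)
  have hXK : X ⊆ K := hX2.trans Finset.sdiff_subset
  have hsum : ∑ b ∈ K, (if b ∈ X then (1 : ℤ) else -1) = 2 * j - K.card := by
    have : ∑ b ∈ K, (if b ∈ X then (1 : ℤ) else -1) = ∑ b ∈ K, ((if b ∈ X then 2 else 0) - 1) :=
      Finset.sum_congr rfl fun u _ => by split_ifs <;> norm_num
    rw [this, Finset.sum_sub_distrib, ← Finset.sum_filter, Finset.filter_mem_eq_inter,
      Finset.inter_eq_right.2 hXK]
    simp [hXc]
    omega
  refine ⟨fun b => if b ∈ X then 1 else -1, fun b _ => ?_, hsum, fun b hb => ?_⟩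
  · by_cases h : b ∈ X <;> simp [h]
  · rw [hsum]
    by_cases h : b ∈ X
    · simp only [h, if_true]
      intro he
      have := hX2 h
      simp only [Finset.mem_filter, Finset.mem_sdiff] at this
      exact this.2 ⟨hb, by omega⟩
    · simp only [h, if_false]
      intro he
      exact h (hX1 (by simp only [Finset.mem_filter]; exact ⟨hb, by omega⟩))

theorem sum_card_fiber_le {V : Type u} (K : Finset V) (g : V → ℤ) (I : Finset ℤ) :
    ∑ i ∈ I, ((K.filter fun b => g b = 2 * i - K.card + 1).card : ℤ) ≤ K.card := by
  rw [← Nat.cast_sum, ← Finset.card_biUnion]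
  · exact_mod_cast Finset.card_le_card (Finset.biUnion_subset.2 fun i _ => Finset.filter_subset _ _)
  · intro i _ j _ hij
    rw [Function.onFun, Finset.disjoint_left]
    intro b h1 h2
    simp only [Finset.mem_filter] at h1 h2
    omega

/-- Signs on the edges of a star with `#K ≥ 2` leaves can avoid, for each leaf `b`, one forbidden
value of the total at the centre minus the sign at `b`. -/
theorem exists_star_signs {V : Type u} (K : Finset V) (g : V → ℤ) (hK : 2 ≤ K.card) :
    ∃ σ : V → ℤ, (∀ b ∈ K, σ b = 1 ∨ σ b = -1) ∧ ∀ b ∈ K, ∑ c ∈ K, σ c - σ b ≠ g b := by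
  obtain ⟨j, h1, h2, h3, h4⟩ := exists_index (k := K.card)
    (a := fun i => ((K.filter fun b => g b = 2 * i - K.card + 1).card : ℤ))
    (fun i => by positivity) (sum_card_fiber_le K g) (by exact_mod_cast hK)
  obtain ⟨σ, hσ, -, hσ'⟩ := exists_star_signs_of_index K g h1 h2 h3 h4
  exact ⟨σ, hσ, hσ'⟩

/-- With at least four leaves, one value of the total at the centre can be avoided as well. -/
theorem exists_star_signs_sum_ne {V : Type u} (K : Finset V) (g : V → ℤ) (g₀ : ℤ)
    (hK : 4 ≤ K.card) :
    ∃ σ : V → ℤ, (∀ b ∈ K, σ b = 1 ∨ σ b = -1) ∧ ∑ b ∈ K, σ b ≠ g₀ ∧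
      ∀ b ∈ K, ∑ c ∈ K, σ c - σ b ≠ g b := by
  obtain ⟨j, h0, h1, h2, h3, h4⟩ := exists_index_ne (k := K.card)
    (a := fun i => ((K.filter fun b => g b = 2 * i - K.card + 1).card : ℤ))
    (fun i => by positivity) (sum_card_fiber_le K g) (by exact_mod_cast hK) ((g₀ + K.card) / 2)
  obtain ⟨σ, hσ, hs, hσ'⟩ := exists_star_signs_of_index K g h1 h2 h3 h4
  exact ⟨σ, hσ, by omega, hσ'⟩

/-! ### One exceptional vertex -/

/-- The subgraph of the edges with exactly one end in `B`. -/
def crossing {V : Type u} (G : SimpleGraph V) (B : Set V) : SimpleGraph V where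
  Adj a b := G.Adj a b ∧ ¬ (a ∈ B ↔ b ∈ B)
  symm := ⟨fun _ _ h => ⟨h.1.symm, fun h' => h.2 h'.symm⟩⟩
  loopless := ⟨fun _ h => h.1.ne rfl⟩

/-- The subgraph of the edges with no end in `A`, as a graph on all vertices. -/
def avoiding {V : Type u} (H : SimpleGraph V) (A : Set V) : SimpleGraph V where
  Adj a b := H.Adj a b ∧ a ∉ A ∧ b ∉ A
  symm := ⟨fun _ _ h => ⟨h.1.symm, h.2.2, h.2.1⟩⟩
  loopless := ⟨fun _ h => h.1.ne rfl⟩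

/-- The red vertices (those outside `B`) other than `v`. -/
def redsExcept {V : Type u} (B : Set V) (v : V) : Set V := {a | a ∉ B ∧ a ≠ v}

/-- Residues for `Rd` as provided by `exists_residues`. -/
noncomputable def residues {V : Type u} [Fintype V] (G : SimpleGraph V) (Rd : Set V) : V → ℤ :=
  (G.exists_residues Rd).choose

/-- Perturbations that are tame for the red vertices other than `v`; the sums at the exceptional
vertex `v` and at the blue vertices are free. -/
abbrev IsTameAt {V : Type u} [Fintype V] (G : SimpleGraph V) (B : Set V) (v : V)
    (ε : V → V → ℤ) : Prop :=
  G.IsTame (redsExcept B v) (G.residues (redsExcept B v)) ε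

/-- A `T`-join when part of `T` is not connected to the root but consists of adjacent pairs `P`. -/
theorem exists_join_of_pairs {V : Type u} [Fintype V] (H : SimpleGraph V) (r : V)
    (τ : V → ZMod 2) (P : V → V → Prop) (hPs : ∀ a b, P a b → P b a)
    (hPf : ∀ a b c, P a b → P a c → b = c) (hPa : ∀ a b, P a b → H.Adj a b)
    (hPτ : ∀ a b, P a b → τ a = 1)
    (hr : ∀ a, τ a ≠ 0 → (∀ b, ¬ P a b) → H.Reachable a r) (hs : ∑ a, τ a = 0) :
    ∃ x : V → V → ZMod 2, (∀ p q, x p q = x q p) ∧ (∀ p q, ¬ H.Adj p q → x p q = 0) ∧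
      ∀ p, ∑ q, x p q = τ p := by
  let s : V → ZMod 2 := fun a => if ∃ b, P a b then 1 else 0
  let τ' : V → ZMod 2 := fun a => if ∃ b, P a b then 0 else τ a
  have hτ : ∀ a, τ a = τ' a + s a := by
    intro a
    by_cases h : ∃ b, P a b
    · obtain ⟨b, hb⟩ := h
      have : ∃ b, P a b := ⟨b, hb⟩
      simp [τ', s, this, hPτ a b hb]
    · simp [τ', s, h]
  have hs0 : ∑ a, s a = 0 := by
    have hch : ∀ a, ∃ b, (∃ b, P a b) → P a b := fun a => by
      by_cases h : ∃ b, P a b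
      · exact ⟨h.choose, fun _ => h.choose_spec⟩
      · exact ⟨a, fun h' => absurd h' h⟩
    choose g hg using hch
    have hgP : ∀ a, s a ≠ 0 → P a (g a) := fun a ha => hg a (by
      by_contra h
      exact ha (by simp only [s, h, if_false]))
    have hex : ∀ a, s a ≠ 0 → s (g a) = 1 := fun a ha => by
      have : ∃ b, P (g a) b := ⟨a, hPs _ _ (hgP a ha)⟩
      simp only [s, this, if_true]
    rw [← Finset.sum_filter_ne_zero]
    refine Finset.sum_involution (fun a _ => g a) (fun a ha => ?_) (fun a ha _ => ?_)
      (fun a ha => ?_) (fun a ha => ?_)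
    · have ha := (Finset.mem_filter.1 ha).2
      have h1 : s a = 1 := by
        have : ∃ b, P a b := ⟨_, hgP a ha⟩
        simp only [s, this, if_true]
      rw [hex a ha, h1]; decide
    · have ha := (Finset.mem_filter.1 ha).2
      exact fun h => (hPa _ _ (hgP a ha)).ne h.symm
    · have ha := (Finset.mem_filter.1 ha).2
      simp [hex a ha]
    · have ha := (Finset.mem_filter.1 ha).2
      have h1 := hPs _ _ (hgP a ha)
      exact hPf _ _ _ (hgP _ (by rw [hex a ha]; decide)) h1
  obtain ⟨x, h1, h2, h3⟩ := exists_join H r τ' (fun a ha => by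
      by_cases h : ∃ b, P a b
      · simp [τ', h] at ha
      · have h' : τ' a = τ a := by simp [τ', h]
        exact hr a (h' ▸ ha) fun b hb => h ⟨b, hb⟩) (by
      rw [← hs, Finset.sum_congr rfl fun a _ => hτ a, Finset.sum_add_distrib, hs0, add_zero])
  refine ⟨fun p q => x p q + if P p q then 1 else 0, fun p q => ?_, fun p q hpq => ?_,
    fun p => ?_⟩
  · have : P p q ↔ P q p := ⟨hPs _ _, hPs _ _⟩
    simp only [h1 p q, this]
  · have : ¬ P p q := fun h => hpq (hPa _ _ h)
    simp [h2 p q hpq, this]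
  · rw [Finset.sum_add_distrib, h3, hτ p]
    congr 1
    by_cases h : ∃ b, P p b
    · obtain ⟨b, hb⟩ := h
      have h' : ∃ b, P p b := ⟨b, hb⟩
      have : ∀ q, P p q ↔ q = b := fun q => ⟨fun hq => hPf _ _ _ hq hb, fun e => e ▸ hb⟩
      simp [s, this]
    · have : ∀ q, ¬ P p q := fun q hq => h ⟨q, hq⟩
      simp [s, this]

/-- The situation left by the parity argument: `B` is independent, the number of red vertices is
odd, and no good perturbation exists. -/
structure IsObstruction {V : Type u} [Fintype V] (G : SimpleGraph V) (B : Set V) : Prop where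
  indep : ∀ a ∈ B, ∀ b ∈ B, ¬ G.Adj a b
  odd : ∑ a : V, (if a ∈ B then (0 : ZMod 2) else 1) = 1
  bad : ¬ G.HasGoodPerturbation

namespace IsObstruction

variable {V : Type u} [Fintype V] {G : SimpleGraph V} {B : Set V}

/-- A tame perturbation with even sums at `v` and on `B` leaves `v` in conflict with a blue
neighbour. -/
theorem conflict (h : G.IsObstruction B) {v : V} (hv : v ∉ B) {ε : V → V → ℤ}
    (ht : G.IsTameAt B v ε) (hev : Even (∑ c, ε v c)) (heb : ∀ b ∈ B, Even (∑ c, ε b c)) :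
    ∃ b ∈ B, G.Adj v b ∧
      2 * G.intDegree v + ∑ c, ε v c = 2 * G.intDegree b + ∑ c, ε b c := by
  by_contra hno
  push Not at hno
  have hm : ∀ a, a ∉ redsExcept B v → a ∈ B ∨ a = v := fun a ha => by
    by_contra h'
    push Not at h'
    exact ha h'
  refine h.bad ((G.exists_residues (redsExcept B v)).choose_spec.2 ε ht (fun a ha => ?_)
    (fun a ha b hb hab => ?_))
  · rcases hm a ha with h1 | rfl
    exacts [heb a h1, hev]
  · rcases hm a ha with h1 | rfl <;> rcases hm b hb with h2 | rfl
    · exact absurd hab (h.indep a h1 b h2)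
    · exact (hno a h1 hab.symm).symm
    · exact hno b h2 hab
    · exact absurd rfl hab.ne

/-- Tame perturbations with parities `τ`, supported on a subgraph `H` without edges inside the
prescribed set. -/
theorem exists_tame {v : V} (H : SimpleGraph V)
    (hHG : ∀ p q, H.Adj p q → G.Adj p q)
    (hHR : ∀ p q, H.Adj p q → p ∈ redsExcept B v → q ∉ redsExcept B v)
    (r : V) (τ : V → ZMod 2) (P : V → V → Prop) (hPs : ∀ a b, P a b → P b a)
    (hPf : ∀ a b c, P a b → P a c → b = c) (hPa : ∀ a b, P a b → H.Adj a b)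
    (hPτ : ∀ a b, P a b → τ a = 1)
    (hr : ∀ a, τ a ≠ 0 → (∀ b, ¬ P a b) → H.Reachable a r) (hs : ∑ a, τ a = 0)
    (hτ : ∀ a ∈ redsExcept B v, τ a = 1) :
    ∃ ε, G.IsTameAt B v ε ∧ (∀ p q, ¬ H.Adj p q → ε p q = 0) ∧
      ∀ p, (τ p = 0 → Even (∑ q, ε p q)) ∧ (τ p = 1 → Odd (∑ q, ε p q)) := by
  obtain ⟨x, h1, h2, h3⟩ := exists_join_of_pairs H r τ P hPs hPf hPa hPτ hr hs
  obtain ⟨ε, hε, hx⟩ := exists_isTame G (redsExcept B v)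
    (G.exists_residues (redsExcept B v)).choose_spec.1 x h1
    (fun p q hpq => h2 p q fun h => hpq (hHG p q h))
    (fun p hp q hq => h2 p q fun h => hHR p q h hp hq) (fun p hp => by rw [h3, hτ p hp])
  have hsum : ∀ p, ((∑ q, ε p q : ℤ) : ZMod 2) = τ p := fun p => by
    rw [Int.cast_sum, ← h3 p]
    exact Finset.sum_congr rfl fun q _ => hx p q
  refine ⟨ε, hε, fun p q hpq => ?_, fun p => ⟨fun h => ?_, fun h => ?_⟩⟩
  · have h5 := hx p q
    rw [h2 p q hpq, intCast_zmod_two_eq_zero] at h5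
    have h6 := abs_le.1 (hε.le p q)
    obtain ⟨k, hk⟩ := h5
    omega
  · rw [← intCast_zmod_two_eq_zero, hsum, h]
  · rw [← intCast_zmod_two_eq_one, hsum, h]

theorem isTameAt_add_star {v : V} {ε : V → V → ℤ} (ht : G.IsTameAt B v ε) (hv : v ∉ B)
    (σ : V → ℤ) (hσ : ∀ q, σ q ≠ 0 → q ∈ B ∧ G.Adj v q ∧ |σ q| ≤ 1 ∧ ε v q = 0) :
    G.IsTameAt B v fun p q => ε p q + starFun v σ p q := by
  have hσv : σ v = 0 := by
    by_contra h
    exact hv (hσ v h).1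
  refine ht.modify ⟨fun a b => by rw [ht.symm, starFun_symm], fun a b hab => ?_, fun a b => ?_⟩
    (fun a ha b hb => ?_) (fun a ha => Or.inl ?_)
  · rw [ht.supp a b hab, zero_add]
    unfold starFun
    split_ifs with h1 h2
    · subst h1
      by_contra h3
      exact hab (hσ b h3).2.1
    · subst h2
      by_contra h3
      exact hab (hσ a h3).2.1.symm
    · rfl
  · unfold starFun
    split_ifs with h1 h2
    · subst h1
      by_cases h3 : σ b = 0
      · rw [h3, add_zero]; exact ht.le _ _
      · rw [(hσ b h3).2.2.2, zero_add]; exact (hσ b h3).2.2.1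
    · subst h2
      by_cases h3 : σ a = 0
      · rw [h3, add_zero]; exact ht.le _ _
      · rw [ht.symm, (hσ a h3).2.2.2, zero_add]; exact (hσ a h3).2.2.1
    · rw [add_zero]; exact ht.le _ _
  · rw [ht.zero a ha b hb, zero_add]
    simp [starFun, ha.2, hb.2]
  · rw [Finset.sum_add_distrib, sum_starFun_of_ne _ ha.2]
    have : σ a = 0 := by
      by_contra h3
      exact ha.1 (hσ a h3).1
    rw [this, add_zero]

/-- The conflict after the values `σ` have been added on edges from `v` to `B`. -/
theorem conflict_star (h : G.IsObstruction B) {v : V} (hv : v ∉ B) {ε : V → V → ℤ}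
    (ht : G.IsTameAt B v ε) (σ : V → ℤ)
    (hσ : ∀ q, σ q ≠ 0 → q ∈ B ∧ G.Adj v q ∧ |σ q| ≤ 1 ∧ ε v q = 0)
    (hev : Even (∑ c, ε v c + ∑ c, σ c)) (heb : ∀ b ∈ B, Even (∑ c, ε b c + σ b)) :
    ∃ b ∈ B, G.Adj v b ∧ 2 * G.intDegree v + (∑ c, ε v c + ∑ c, σ c) =
      2 * G.intDegree b + (∑ c, ε b c + σ b) := by
  have e1 : ∑ c, (ε v c + starFun v σ v c) = ∑ c, ε v c + ∑ c, σ c := by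
    rw [Finset.sum_add_distrib, sum_starFun_self]
  have e2 : ∀ b ∈ B, ∑ c, (ε b c + starFun v σ b c) = ∑ c, ε b c + σ b := fun b hb => by
    rw [Finset.sum_add_distrib, sum_starFun_of_ne _ (show b ≠ v from fun e => hv (e ▸ hb))]
  obtain ⟨b, hb, hvb, he⟩ := h.conflict hv (isTameAt_add_star ht hv σ hσ) (by rw [e1]; exact hev)
    (fun b hb => by rw [e2 b hb]; exact heb b hb)
  rw [e1, e2 b hb] at he
  exact ⟨b, hb, hvb, he⟩

/-- The sign of an edge at a red vertex without red neighbours is free. -/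
theorem isTameAt_toggle {v : V} {ε : V → V → ℤ} (ht : G.IsTameAt B v ε) {x b : V} (hxB : x ∉ B)
    (hxv : x ≠ v) (hb : b ∈ B) (hfree : ∀ w, G.Adj x w → w ∈ B) :
    (G.IsTameAt B v fun p q => ε p q + edgeFun x b (-2 * ε x b) p q) ∧
      ∀ p, ∑ q, (ε p q + edgeFun x b (-2 * ε x b) p q) = ∑ q, ε p q +
        ((if p = x then -2 * ε x b else 0) + (if p = b then -2 * ε x b else 0)) := by
  have hxb : x ≠ b := fun e => hxB (e ▸ hb)
  have hsum : ∀ p, ∑ q, (ε p q + edgeFun x b (-2 * ε x b) p q) = ∑ q, ε p q +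
        ((if p = x then -2 * ε x b else 0) + (if p = b then -2 * ε x b else 0)) := fun p => by
    rw [Finset.sum_add_distrib, sum_edgeFun hxb]
  have hval : ∀ p q, ε p q + edgeFun x b (-2 * ε x b) p q = ε p q ∨
      ε p q + edgeFun x b (-2 * ε x b) p q = - ε p q := fun p q => by
    unfold edgeFun
    split_ifs with h1
    · right
      rcases h1 with ⟨rfl, rfl⟩ | ⟨rfl, rfl⟩
      · ring
      · rw [ht.symm q p]; ring
    · left; ring
  refine ⟨ht.modify ⟨fun p q => by rw [ht.symm, edgeFun_symm], fun p q hpq => ?_, fun p q => ?_⟩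
    (fun p hp q hq => ?_) (fun p hp => ?_), hsum⟩
  · rcases hval p q with e | e <;> rw [e, ht.supp p q hpq]
    rfl
  · rcases hval p q with e | e <;> rw [e]
    · exact ht.le p q
    · rw [abs_neg]; exact ht.le p q
  · rcases hval p q with e | e <;> rw [e, ht.zero p hp q hq]
    rfl
  · rw [hsum]
    have hpb : p ≠ b := fun e => hp.1 (e ▸ hb)
    by_cases hpx : p = x
    · subst hpx
      refine Or.inr ⟨fun w hw hpw => hw.1 (hfree w hpw), ?_⟩
      simp only [if_true, hpb, if_false, add_zero]
      refine (ht.odd p hp).add_even ?_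
      rw [neg_mul]
      exact (even_two_mul _).neg
    · left
      simp [hpb, hpx]

end IsObstruction

/-! ### Resolving conflicts at the exceptional vertex -/

/-- Removing a vertex with a single neighbour leaves the rest connected. -/
theorem Reachable.avoiding_of_unique_adj {V : Type u} {H : SimpleGraph V} {u c : V}
    (huc : H.Adj u c) (hu : ∀ w, H.Adj u w → w = c) {a r : V} (h : H.Reachable a r) (ha : a ≠ u)
    (hr : r ≠ u) : (H.avoiding {u}).Reachable a r := by
  have key : ∀ a r, H.Reachable a r → r ≠ u → (a ≠ u → (H.avoiding {u}).Reachable a r) ∧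
      (a = u → (H.avoiding {u}).Reachable c r) := by
    rintro a r ⟨w⟩ hr
    induction w with
    | nil => exact ⟨fun _ => Reachable.refl _, fun e => absurd e hr⟩
    | @cons a b r hab _ ih =>
      refine ⟨fun ha => ?_, fun ha => ?_⟩
      · by_cases hb : b = u
        · rw [hu a (hb ▸ hab.symm)]
          exact (ih hr).2 hb
        · exact Reachable.trans (Adj.reachable ⟨hab, ha, hb⟩) ((ih hr).1 hb)
      · subst ha
        rw [← hu b hab]
        exact (ih hr).1 hab.ne'
  exact (key a r h hr).1 ha

theorem intDegree_eq_card {V : Type u} [Fintype V] (G : SimpleGraph V) (v : V) :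
    G.intDegree v = ((univ.filter fun w => G.Adj v w).card : ℤ) := by
  simp [intDegree]

theorem exists_three_of_intDegree {V : Type u} [Fintype V] {G : SimpleGraph V} {v b : V}
    (h : G.intDegree v = 3) (hb : G.Adj v b) :
    ∃ b₁ b₂, b ≠ b₁ ∧ b ≠ b₂ ∧ b₁ ≠ b₂ ∧ ∀ w, G.Adj v w ↔ w = b ∨ w = b₁ ∨ w = b₂ := by
  rw [intDegree_eq_card] at h
  have hm : b ∈ univ.filter fun w => G.Adj v w := by simpa using hb
  have h2 := Finset.card_erase_of_mem hm
  have h3 : ((univ.filter fun w => G.Adj v w).erase b).card = 2 := by omega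
  obtain ⟨b₁, b₂, h12, he⟩ := Finset.card_eq_two.1 h3
  have hmem : ∀ w, w ∈ (univ.filter fun w => G.Adj v w).erase b ↔ w = b₁ ∨ w = b₂ := by
    intro w; rw [he]; simp
  simp only [Finset.mem_erase, Finset.mem_filter, Finset.mem_univ, true_and] at hmem
  refine ⟨b₁, b₂, (((hmem b₁).2 (Or.inl rfl)).1).symm, (((hmem b₂).2 (Or.inr rfl)).1).symm, h12,
    fun w => ⟨fun hw => ?_, ?_⟩⟩
  · by_cases h : w = b
    exacts [Or.inl h, Or.inr ((hmem w).1 ⟨h, hw⟩)]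
  · rintro (rfl | rfl | rfl)
    exacts [hb, ((hmem _).2 (Or.inl rfl)).2, ((hmem _).2 (Or.inr rfl)).2]

theorem IsPerturbation.add_edge {V : Type u} {G : SimpleGraph V} {ε : V → V → ℤ}
    (h : G.IsPerturbation ε) {a b : V} (hab : G.Adj a b) {t : ℤ} (ht : |ε a b + t| ≤ 1) :
    G.IsPerturbation fun p q => ε p q + edgeFun a b t p q where
  symm p q := by rw [h.symm, edgeFun_symm]
  supp p q hpq := by
    rw [h.supp p q hpq, zero_add, edgeFun, if_neg]
    rintro (⟨rfl, rfl⟩ | ⟨rfl, rfl⟩)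
    exacts [hpq hab, hpq hab.symm]
  le p q := by
    unfold edgeFun
    split_ifs with h1
    · rcases h1 with ⟨rfl, rfl⟩ | ⟨rfl, rfl⟩
      · exact ht
      · rw [h.symm]; exact ht
    · rw [add_zero]; exact h.le p q

/-- A red vertex all of whose neighbours are blue, with `v` and its neighbours of degree `3`. -/
structure IsCubicAt {V : Type u} [Fintype V] (G : SimpleGraph V) (B : Set V) (v : V) : Prop where
  sub : ∀ w, G.Adj v w → w ∈ B
  deg : G.intDegree v = 3
  deg_nbr : ∀ w, G.Adj v w → G.intDegree w = 3

/-- A blue vertex `c` and a red vertex `u` that form a component of the crossing graph once `v` is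
removed. -/
structure IsSmallPair {V : Type u} (G : SimpleGraph V) (B : Set V) (v c u : V) : Prop where
  blue : c ∈ B
  adj : G.Adj v c
  red : u ∉ B
  ne : u ≠ v
  adj' : G.Adj u c
  nbr : ∀ w, G.Adj c w → w = v ∨ w = u
  nbr' : ∀ w ∈ B, G.Adj u w → w = c

namespace IsObstruction

variable {V : Type u} [Fintype V] {G : SimpleGraph V} {B : Set V}

/-- The tame perturbation with odd sums exactly at the red vertices and at the set `K` of blue
vertices; at the exceptional vertex the parity is `t`. -/
theorem exists_tame_of_odd (h : G.IsObstruction B) {v : V} (hv : v ∉ B) (H : SimpleGraph V)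
    (hHG : ∀ p q, H.Adj p q → G.Adj p q)
    (hHR : ∀ p q, H.Adj p q → p ∈ redsExcept B v → q ∉ redsExcept B v)
    (r : V) (K : Finset V) (hKB : ∀ b ∈ K, b ∈ B) (t : ZMod 2) (hKt : (K.card : ZMod 2) = t)
    (P : V → V → Prop) (hPs : ∀ a b, P a b → P b a)
    (hPf : ∀ a b c, P a b → P a c → b = c) (hPa : ∀ a b, P a b → H.Adj a b)
    (hPv : ∀ a b, P a b → a ≠ v) (hPK : ∀ a b, P a b → a ∈ B → a ∈ K)
    (hrv : t ≠ 0 → H.Reachable v r)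
    (hr : ∀ a, a ≠ v → (a ∈ B → a ∈ K) → (∀ b, ¬ P a b) → H.Reachable a r) :
    ∃ ε, G.IsTameAt B v ε ∧ (∀ p q, ¬ H.Adj p q → ε p q = 0) ∧
      (∀ b ∈ K, Odd (∑ q, ε b q)) ∧ (∀ b ∈ B, b ∉ K → Even (∑ q, ε b q)) ∧
      (t = 0 → Even (∑ q, ε v q)) ∧ (t = 1 → Odd (∑ q, ε v q)) := by
  let τ : V → ZMod 2 := fun a => (if a ∈ B then 0 else 1) + (if a ∈ K then 1 else 0)
    + (if a = v then 1 + t else 0)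
  have hvK : v ∉ K := fun hk => hv (hKB v hk)
  have hτv : τ v = t := by
    have aux : ∀ t : ZMod 2, 1 + 0 + (1 + t) = t := by decide
    simp only [τ, hv, hvK, if_true, if_false]
    exact aux t
  have hτK : ∀ b ∈ K, τ b = 1 := fun b hb => by
    have : b ≠ v := fun e => hvK (e ▸ hb)
    simp [τ, hKB b hb, hb, this]
  have hτB : ∀ b ∈ B, b ∉ K → τ b = 0 := fun b hb hbK => by
    have : b ≠ v := fun e => hv (e ▸ hb)
    simp [τ, hb, hbK, this]
  have hτR : ∀ a ∈ redsExcept B v, τ a = 1 := fun a ha => by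
    have : a ∉ K := fun hk => ha.1 (hKB a hk)
    simp [τ, ha.1, ha.2, this]
  have hsum : ∑ a, τ a = 0 := by
    simp only [τ, Finset.sum_add_distrib, h.odd]
    rw [Finset.sum_ite_eq' univ v, Finset.sum_ite_mem]
    have aux : ∀ t : ZMod 2, 1 + t + (1 + t) = 0 := by decide
    simp only [Finset.univ_inter, Finset.sum_const, nsmul_eq_mul, mul_one, hKt,
      Finset.mem_univ, if_true]
    exact aux t
  obtain ⟨ε, h1, h2, h3⟩ := exists_tame (v := v) H hHG hHR r τ P hPs hPf hPa
    (fun a b hab => by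
      by_cases ha : a ∈ B
      · exact hτK a (hPK a b hab ha)
      · exact hτR a ⟨ha, hPv a b hab⟩)
    (fun a ha hP => by
      by_cases hav : a = v
      · subst hav; exact hrv (by rwa [hτv] at ha)
      · refine hr a hav (fun haB => ?_) hP
        by_contra hk
        exact ha (hτB a haB hk)) hsum hτR
  exact ⟨ε, h1, h2, fun b hb => (h3 b).2 (hτK b hb), fun b hb hbK => (h3 b).1 (hτB b hb hbK),
    fun e => (h3 v).1 (hτv.trans e), fun e => (h3 v).2 (hτv.trans e)⟩

theorem crossing_avoiding_adj_reds {v : V} (p q : V) (hpq : ((G.crossing B).avoiding {v}).Adj p q)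
    (hp : p ∈ redsExcept B v) : q ∉ redsExcept B v := fun hq =>
  hpq.1.2 ⟨fun h => absurd h hp.1, fun h => absurd h hq.1⟩

/-- If the crossing graph stays connected without the red vertex `v`, the edges at `v` can all be
left at weight `2`. -/
theorem exists_tame_zero (h : G.IsObstruction B) {v : V} (hv : v ∉ B) (r : V)
    (hr : ∀ a, a ≠ v → ((G.crossing B).avoiding {v}).Reachable a r) :
    ∃ ε, G.IsTameAt B v ε ∧ (∀ q, ε v q = 0) ∧ ∀ b ∈ B, Even (∑ q, ε b q) := by
  obtain ⟨ε, h1, h2, -, h4, -⟩ := h.exists_tame_of_odd hv ((G.crossing B).avoiding {v})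
    (fun p q hpq => hpq.1.1) crossing_avoiding_adj_reds r ∅ (by simp) 0 (by simp)
    (fun _ _ => False) (by simp) (by simp) (by simp) (by simp) (by simp) (by simp)
    (fun a ha _ _ => hr a ha)
  exact ⟨ε, h1, fun q => h2 v q fun h => h.2.1 rfl, fun b hb => h4 b hb (by simp)⟩

theorem reachable_avoiding_of_private (hc : ∀ a b, (G.crossing B).Reachable a b) {u c : V}
    (hu : u ∉ B) (hcB : c ∈ B) (huc : G.Adj u c) (hpriv : ∀ w ∈ B, G.Adj u w → w = c) (a : V)
    (ha : a ≠ u) : ((G.crossing B).avoiding {u}).Reachable a c := by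
  refine Reachable.avoiding_of_unique_adj (H := G.crossing B) (c := c) ⟨huc, fun h => hu (h.2 hcB)⟩ (fun w hw => ?_)
    (hc a c) ha huc.ne'
  exact hpriv w (by
    by_contra hwB
    exact hw.2 ⟨fun h => absurd h hu, fun h => absurd h hwB⟩) hw.1

/-- A red vertex with a single blue neighbour `c` has no common neighbour with `c`: the triangle
would allow the conflict between them to be resolved. -/
theorem private_not_adj (h : G.IsObstruction B) (hc : ∀ a b, (G.crossing B).Reachable a b)
    {u c y : V} (hu : u ∉ B) (hcB : c ∈ B) (huc : G.Adj u c)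
    (hpriv : ∀ w ∈ B, G.Adj u w → w = c) (huy : G.Adj u y) (hcy : G.Adj c y) : False := by
  obtain ⟨ε, ht, hε0, hεB⟩ := h.exists_tame_zero hu c
    (reachable_avoiding_of_private hc hu hcB huc hpriv)
  have hyB : y ∉ B := fun hy => h.indep c hcB y hy hcy
  have hsu : ∑ q, ε u q = 0 := Finset.sum_eq_zero fun q _ => hε0 q
  obtain ⟨b, hb, hub, he⟩ := h.conflict hu ht (by rw [hsu]; exact Even.zero) hεB
  obtain rfl := hpriv b hb hub
  rw [hsu] at he
  -- move the value `e` from the edge `y b` to `y u`, and raise `u b` by one: the sum at `y` does not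
  -- change, while the two ends of the conflict move by `1 + e` and `1 - e`
  obtain ⟨e, he1, he0, hee⟩ : ∃ e : ℤ, |e| ≤ 1 ∧ e ≠ 0 ∧ |ε y b - e| ≤ 1 := by
    by_cases h0 : ε y b = 0
    · exact ⟨1, by norm_num, by norm_num, by rw [h0]; norm_num⟩
    · exact ⟨ε y b, ht.le _ _, h0, by norm_num⟩
  have hp1 := ht.toIsPerturbation.add_edge huy.symm (t := e) (by
    rw [ht.symm, hε0, zero_add]; exact he1)
  have hp2 := hp1.add_edge hcy.symm (t := -e) (by
    simpa [edgeFun, huc.ne', huy.ne', sub_eq_add_neg] using hee)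
  have hp3 := hp2.add_edge huc (t := 1) (by
    simp [edgeFun, huc.ne', huy.ne, hε0, hcy.ne, huc.ne])
  have hs3 : ∀ p, ∑ q, (ε p q + edgeFun y u e p q + edgeFun y b (-e) p q + edgeFun u b 1 p q) =
      ∑ q, ε p q + ((if p = y then e else 0) + (if p = u then e else 0)) +
        ((if p = y then -e else 0) + (if p = b then -e else 0)) +
        ((if p = u then 1 else 0) + (if p = b then 1 else 0)) := fun p => by
    rw [Finset.sum_add_distrib, Finset.sum_add_distrib, Finset.sum_add_distrib,
      sum_edgeFun huy.ne', sum_edgeFun hcy.ne', sum_edgeFun huc.ne]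
  have ht3 := ht.modify hp3 (fun p hp q hq => by
      have h1 : p ≠ b := fun e => hp.1 (e ▸ hb)
      have h2 : q ≠ b := fun e => hq.1 (e ▸ hb)
      simp [edgeFun, h1, h2, hp.2, hq.2, ht.zero p hp q hq]) (fun p hp => Or.inl (by
      have h1 : p ≠ b := fun e => hp.1 (e ▸ hb)
      rw [hs3]
      simp only [h1, hp.2, if_false]
      split_ifs <;> ring))
  have hsu3 := hs3 u
  have hsb3 := hs3 b
  simp only [huy.ne, huc.ne, if_true, if_false, hsu] at hsu3
  simp only [hcy.ne, huc.ne', if_true, if_false] at hsb3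
  have he2 : e = 1 ∨ e = -1 := by
    rw [abs_le] at he1
    omega
  obtain ⟨b', hb', hub', he'⟩ := h.conflict hu ht3 (by
      rw [hsu3]
      rcases he2 with rfl | rfl <;> decide) (fun p hp => by
      have h1 : p ≠ u := fun e => hu (e ▸ hp)
      have h2 : p ≠ y := fun e => hyB (e ▸ hp)
      rw [hs3]
      have h3 := hεB p hp
      simp only [h1, h2, if_false]
      obtain ⟨k, hk⟩ := h3
      rw [hk]
      by_cases h4 : p = b
      · simp only [h4, if_true]
        rcases he2 with rfl | rfl
        · exact ⟨k, by ring⟩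
        · exact ⟨k + 1, by ring⟩
      · simp only [h4, if_false]
        exact ⟨k, by ring⟩)
  obtain rfl := hpriv b' hb' hub'
  rw [hsu3, hsb3] at he'
  omega

/-- If `N(v) = {b₀, b₁, b₂}` is blue and no sign pattern on `v b₁`, `v b₂` resolves the conflicts
at `v`, for `ε` and for `-ε`, then all degrees agree and the sums at the three neighbours
cancel. -/
theorem sum_eq_zero_of_three (h : G.IsObstruction B) {v b₀ b₁ b₂ : V} (hv : v ∉ B)
    {ε : V → V → ℤ} (ht : G.IsTameAt B v ε) (hε0 : ∀ q, ε v q = 0) (h01 : b₀ ≠ b₁) (h02 : b₀ ≠ b₂)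
    (h12 : b₁ ≠ b₂) (hN : ∀ w, G.Adj v w ↔ w = b₀ ∨ w = b₁ ∨ w = b₂) (hB : ∀ w, G.Adj v w → w ∈ B)
    (ho1 : Odd (∑ q, ε b₁ q)) (ho2 : Odd (∑ q, ε b₂ q))
    (hev : ∀ b ∈ B, b ≠ b₁ → b ≠ b₂ → Even (∑ q, ε b q)) :
    G.intDegree b₀ = G.intDegree v ∧ G.intDegree b₁ = G.intDegree v ∧
      G.intDegree b₂ = G.intDegree v ∧ ∑ q, ε b₀ q + ∑ q, ε b₁ q + ∑ q, ε b₂ q = 0 := by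
  have key : ∀ ε : V → V → ℤ, G.IsTameAt B v ε → (∀ q, ε v q = 0) → Odd (∑ q, ε b₁ q) →
      Odd (∑ q, ε b₂ q) → (∀ b ∈ B, b ≠ b₁ → b ≠ b₂ → Even (∑ q, ε b q)) →
      ∀ s₁ s₂ : ℤ, (s₁ = 1 ∨ s₁ = -1) → (s₂ = 1 ∨ s₂ = -1) →
        2 * G.intDegree v + s₁ + s₂ = 2 * G.intDegree b₀ + ∑ q, ε b₀ q ∨
        2 * G.intDegree v + s₂ = 2 * G.intDegree b₁ + ∑ q, ε b₁ q ∨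
        2 * G.intDegree v + s₁ = 2 * G.intDegree b₂ + ∑ q, ε b₂ q := by
    intro ε ht hε0 ho1 ho2 hev s₁ s₂ hs1 hs2
    have hsv : ∑ q, ε v q = 0 := Finset.sum_eq_zero fun q _ => hε0 q
    let σ : V → ℤ := fun q => (if q = b₁ then s₁ else 0) + (if q = b₂ then s₂ else 0)
    have hσs : ∑ q, σ q = s₁ + s₂ := by simp [σ, Finset.sum_add_distrib]
    have hσ1 : σ b₁ = s₁ := by simp [σ, h12]
    have hσ2 : σ b₂ = s₂ := by simp [σ, h12.symm]
    have hσ0 : ∀ q, q ≠ b₁ → q ≠ b₂ → σ q = 0 := fun q h1 h2 => by simp [σ, h1, h2]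
    have hodd : ∀ s : ℤ, (s = 1 ∨ s = -1) → Odd s := by rintro s (rfl | rfl) <;> decide
    obtain ⟨b, hb, hvb, he⟩ := h.conflict_star hv ht σ (fun q hq => by
        by_cases h1 : q = b₁
        · subst h1
          have ha := (hN q).2 (Or.inr (Or.inl rfl))
          exact ⟨hB q ha, ha, by rw [hσ1]; rcases hs1 with rfl | rfl <;> norm_num, hε0 q⟩
        · by_cases h2 : q = b₂
          · subst h2
            have ha := (hN q).2 (Or.inr (Or.inr rfl))
            exact ⟨hB q ha, ha, by rw [hσ2]; rcases hs2 with rfl | rfl <;> norm_num, hε0 q⟩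
          · exact absurd (hσ0 q h1 h2) hq)
      (by rw [hsv, hσs, zero_add]; exact (hodd _ hs1).add_odd (hodd _ hs2))
      (fun b hb => by
        by_cases h1 : b = b₁
        · subst h1; rw [hσ1]; exact ho1.add_odd (hodd _ hs1)
        · by_cases h2 : b = b₂
          · subst h2; rw [hσ2]; exact ho2.add_odd (hodd _ hs2)
          · rw [hσ0 b h1 h2, add_zero]; exact hev b hb h1 h2)
    rw [hsv, hσs] at he
    rcases (hN b).1 hvb with rfl | rfl | rfl
    · rw [hσ0 b h01 h02] at he
      left; linarith
    · rw [hσ1] at he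
      right; left; linarith
    · rw [hσ2] at he
      right; right; linarith
  have k1 := key ε ht hε0 ho1 ho2 hev
  have k2 := key _ ht.neg (fun q => by rw [hε0, neg_zero])
    (by rw [Finset.sum_neg_distrib]; exact ho1.neg) (by rw [Finset.sum_neg_distrib]; exact ho2.neg)
    (fun b hb h1 h2 => by rw [Finset.sum_neg_distrib]; exact (hev b hb h1 h2).neg)
  simp only [Finset.sum_neg_distrib] at k2
  obtain ⟨e0, he0⟩ := hev b₀ (hB _ ((hN _).2 (Or.inl rfl))) h01 h02
  obtain ⟨e1, he1⟩ := ho1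
  obtain ⟨e2, he2⟩ := ho2
  have a1 := k1 1 1 (by simp) (by simp)
  have a2 := k1 1 (-1) (by simp) (by simp)
  have a3 := k1 (-1) 1 (by simp) (by simp)
  have a4 := k1 (-1) (-1) (by simp) (by simp)
  have c1 := k2 1 1 (by simp) (by simp)
  have c2 := k2 1 (-1) (by simp) (by simp)
  have c3 := k2 (-1) 1 (by simp) (by simp)
  have c4 := k2 (-1) (-1) (by simp) (by simp)
  clear k1 k2 key
  -- both `ε` and `-ε` force the deviations at `b₁`, `b₂` to be `±1` and the three to cancel
  have A : 2 * G.intDegree b₁ + ∑ q, ε b₁ q - 2 * G.intDegree v ∈ ({1, -1} : Set ℤ) ∧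
      2 * G.intDegree b₂ + ∑ q, ε b₂ q - 2 * G.intDegree v ∈ ({1, -1} : Set ℤ) ∧
      (2 * G.intDegree b₀ + ∑ q, ε b₀ q - 2 * G.intDegree v) +
      (2 * G.intDegree b₁ + ∑ q, ε b₁ q - 2 * G.intDegree v) +
      (2 * G.intDegree b₂ + ∑ q, ε b₂ q - 2 * G.intDegree v) = 0 := by
    clear c1 c2 c3 c4
    simp only [Set.mem_insert_iff, Set.mem_singleton_iff]
    omega
  have C : 2 * G.intDegree b₁ - ∑ q, ε b₁ q - 2 * G.intDegree v ∈ ({1, -1} : Set ℤ) ∧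
      2 * G.intDegree b₂ - ∑ q, ε b₂ q - 2 * G.intDegree v ∈ ({1, -1} : Set ℤ) ∧
      (2 * G.intDegree b₀ - ∑ q, ε b₀ q - 2 * G.intDegree v) +
      (2 * G.intDegree b₁ - ∑ q, ε b₁ q - 2 * G.intDegree v) +
      (2 * G.intDegree b₂ - ∑ q, ε b₂ q - 2 * G.intDegree v) = 0 := by
    clear a1 a2 a3 a4 A
    simp only [Set.mem_insert_iff, Set.mem_singleton_iff]
    omega
  clear a1 a2 a3 a4 c1 c2 c3 c4
  simp only [Set.mem_insert_iff, Set.mem_singleton_iff] at A C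
  omega

end IsObstruction

theorem avoiding_mono {V : Type u} (H : SimpleGraph V) {A A' : Set V} (h : A ⊆ A') :
    H.avoiding A' ≤ H.avoiding A :=
  fun _ _ hab => ⟨hab.1, fun h1 => hab.2.1 (h h1), fun h1 => hab.2.2 (h h1)⟩

namespace IsObstruction

variable {V : Type u} [Fintype V] {G : SimpleGraph V} {B : Set V}

/-- The conflict after signs `σ` have been put on the edges from `v` to the set `K` of the blue
vertices with odd sums. -/
theorem conflict_signs (h : G.IsObstruction B) {v : V} (hv : v ∉ B) {ε : V → V → ℤ}
    (ht : G.IsTameAt B v ε) (K : Finset V) (hK : ∀ b ∈ K, b ∈ B ∧ G.Adj v b ∧ ε v b = 0)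
    (hodd : ∀ b ∈ K, Odd (∑ q, ε b q)) (heven : ∀ b ∈ B, b ∉ K → Even (∑ q, ε b q))
    (hev : Even (∑ q, ε v q + K.card)) (σ : V → ℤ) (hσ : ∀ b ∈ K, σ b = 1 ∨ σ b = -1) :
    ∃ b ∈ B, G.Adj v b ∧ 2 * G.intDegree v + (∑ c, ε v c + ∑ c ∈ K, σ c) =
      2 * G.intDegree b + (∑ c, ε b c + if b ∈ K then σ b else 0) := by
  have hs : ∑ c, (if c ∈ K then σ c else 0) = ∑ c ∈ K, σ c := by
    rw [Finset.sum_ite_mem, Finset.univ_inter]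
  have hpar : Even (∑ c ∈ K, σ c - K.card) := by
    have : ∑ c ∈ K, σ c - K.card = ∑ c ∈ K, (σ c - 1) := by
      rw [Finset.sum_sub_distrib]; simp
    rw [this]
    refine Finset.even_sum _ fun c hc => ?_
    rcases hσ c hc with e | e <;> rw [e] <;> decide
  have hc := h.conflict_star hv ht (fun q => if q ∈ K then σ q else 0) (fun q hq => by
      by_cases hqK : q ∈ K
      · refine ⟨(hK q hqK).1, (hK q hqK).2.1, ?_, (hK q hqK).2.2⟩
        rcases hσ q hqK with e | e <;> simp [hqK, e]
      · simp [hqK] at hq) (by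
      rw [hs]
      have e : ∑ c, ε v c + ∑ c ∈ K, σ c =
          (∑ q, ε v q + K.card) + (∑ c ∈ K, σ c - K.card) := by ring
      rw [e]
      exact hev.add hpar) (fun b hb => by
      by_cases hbK : b ∈ K
      · simp only [hbK, if_true]
        refine (hodd b hbK).add_odd ?_
        rcases hσ b hbK with e | e <;> rw [e] <;> decide
      · simpa only [hbK, if_false, add_zero] using heven b hb hbK)
  rw [hs] at hc
  exact hc

/-- If all blue neighbours of `v` have odd sums, signs on all edges from `v` to them resolve the
conflicts. -/
theorem false_of_full_star (h : G.IsObstruction B) {v : V} (hv : v ∉ B) {ε : V → V → ℤ}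
    (ht : G.IsTameAt B v ε) (K : Finset V) (hK : ∀ b, b ∈ K ↔ b ∈ B ∧ G.Adj v b)
    (hε : ∀ b ∈ B, ε v b = 0)
    (hodd : ∀ b ∈ K, Odd (∑ q, ε b q)) (heven : ∀ b ∈ B, b ∉ K → Even (∑ q, ε b q))
    (hev : Even (∑ q, ε v q + K.card)) (h2 : 2 ≤ K.card) : False := by
  obtain ⟨σ, hσ, hσ'⟩ := exists_star_signs K
    (fun b => 2 * G.intDegree b + ∑ c, ε b c - 2 * G.intDegree v - ∑ c, ε v c) h2
  obtain ⟨b, hb, hvb, he⟩ := h.conflict_signs hv ht K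
    (fun b hb => ⟨((hK b).1 hb).1, ((hK b).1 hb).2, hε b ((hK b).1 hb).1⟩) hodd heven hev σ hσ
  have hbK : b ∈ K := (hK b).2 ⟨hb, hvb⟩
  rw [if_pos hbK] at he
  exact hσ' b hbK (by linarith)

/-- A red vertex `v` with at least two blue neighbours, whose removal leaves the crossing graph
connected up to small pairs, has exactly three neighbours, all blue, and degrees `3` around it:
otherwise signs on the edges at `v` resolve all conflicts. -/
theorem isCubicAt_of_reachable (h : G.IsObstruction B)
    (hc : ∀ a b, (G.crossing B).Reachable a b) {v r : V} (hv : v ∉ B)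
    (hr : ∀ a, a ≠ v → ((G.crossing B).avoiding {v}).Reachable a r ∨
      ∃ a', G.IsSmallPair B v a a' ∨ G.IsSmallPair B v a' a)
    {b₀ b' : V} (hb₀ : b₀ ∈ B) (hb' : b' ∈ B) (hne : b' ≠ b₀) (hvb₀ : G.Adj v b₀)
    (hvb' : G.Adj v b') (hb₀r : ((G.crossing B).avoiding {v}).Reachable b₀ r) :
    G.IsCubicAt B v := by
  set Λ := (G.crossing B).avoiding {v} with hΛ
  -- small pairs that contain the root count as connected to it
  let P : V → V → Prop := fun a b =>
    (G.IsSmallPair B v a b ∨ G.IsSmallPair B v b a) ∧ ¬ Λ.Reachable a r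
  have hSadj : ∀ {a b}, G.IsSmallPair B v a b → Λ.Adj a b := fun {a b} hs =>
    ⟨⟨hs.adj'.symm, fun h' => hs.red (h'.1 hs.blue)⟩, fun e => hv (e ▸ hs.blue), hs.ne⟩
  have hPa : ∀ a b, P a b → Λ.Adj a b := by
    rintro a b ⟨hs | hs, -⟩
    exacts [hSadj hs, (hSadj hs).symm]
  have hPs : ∀ a b, P a b → P b a := fun a b hab =>
    ⟨hab.1.symm, fun hb => hab.2 ((hPa a b hab).reachable.trans hb)⟩
  have hPf : ∀ a b c, P a b → P a c → b = c := by
    rintro a b c ⟨h1 | h1, -⟩ ⟨h2 | h2, -⟩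
    · exact (((h1.nbr c h2.adj'.symm).resolve_left h2.ne)).symm
    · exact absurd h1.blue h2.red
    · exact absurd h2.blue h1.red
    · exact (h1.nbr' c h2.blue h2.adj').symm
  have hPv : ∀ a b, P a b → a ≠ v := fun a b hab => (hPa a b hab).2.1
  let K₀ : Finset V := univ.filter fun b => b ∈ B ∧ G.Adj v b
  have hK₀ : ∀ b, b ∈ K₀ ↔ b ∈ B ∧ G.Adj v b := by simp [K₀]
  have hPK : ∀ a b, P a b → a ∈ B → a ∈ K₀ := by
    rintro a b ⟨h1 | h1, -⟩ ha
    · exact (hK₀ a).2 ⟨ha, h1.adj⟩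
    · exact absurd ha h1.red
  have hreach : ∀ a, a ≠ v → (∀ b, ¬ P a b) → Λ.Reachable a r := fun a ha hP => by
    rcases hr a ha with h1 | ⟨a', h1⟩
    · exact h1
    · by_contra h2
      exact hP a' ⟨h1, h2⟩
  have hΛG : ∀ p q, Λ.Adj p q → G.Adj p q := fun p q hpq => hpq.1.1
  have hΛv : ∀ q, ¬ Λ.Adj v q := fun q hq => hq.2.1 rfl
  have hb₀K : b₀ ∈ K₀ := (hK₀ _).2 ⟨hb₀, hvb₀⟩
  have hd2 : 2 ≤ K₀.card := by
    have : ({b₀, b'} : Finset V) ⊆ K₀ := by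
      intro q hq
      rcases Finset.mem_insert.1 hq with rfl | hq
      · exact hb₀K
      · rw [Finset.mem_singleton.1 hq]; exact (hK₀ _).2 ⟨hb', hvb'⟩
    have h2 := Finset.card_le_card this
    rwa [Finset.card_pair hne.symm] at h2
  rcases Nat.even_or_odd K₀.card with hd | hd
  · exfalso
    obtain ⟨ε, h1, h2, h3, h4, h5, -⟩ := h.exists_tame_of_odd hv Λ hΛG crossing_avoiding_adj_reds r
      K₀ (fun b hb => ((hK₀ b).1 hb).1) 0 ((ZMod.natCast_eq_zero_iff_even).2 hd) P hPs hPf hPa hPv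
      hPK (fun h => absurd rfl h) (fun a ha _ hP => hreach a ha hP)
    refine h.false_of_full_star hv h1 K₀ hK₀ (fun b _ => h2 _ _ (hΛv b)) h3 h4 ?_ hd2
    exact (h5 rfl).add ((Int.even_coe_nat _).2 hd)
  -- with an odd number of blue neighbours, the edge to a red neighbour `y` restores the parity
  by_cases hy : ∃ y, y ∉ B ∧ G.Adj v y
  · exfalso
    obtain ⟨y, hyB, hvy⟩ := hy
    have hyr : Λ.Reachable y r := by
      rcases hr y hvy.ne' with h1 | ⟨a', h1 | h1⟩
      · exact h1
      · exact absurd h1.blue hyB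
      · exact (h.private_not_adj hc hyB h1.blue h1.adj' h1.nbr' hvy.symm h1.adj.symm).elim
    have hedge : ∀ p q, (Λ ⊔ edge v y).Adj p q → Λ.Adj p q ∨ (p = v ∧ q = y) ∨ (p = y ∧ q = v) := by
      intro p q hpq
      rw [sup_adj, edge_adj] at hpq
      tauto
    have hvr : (Λ ⊔ edge v y).Reachable v r := by
      refine Reachable.trans (Adj.reachable ?_) (hyr.mono le_sup_left)
      rw [sup_adj, edge_adj]
      exact Or.inr ⟨Or.inl ⟨rfl, rfl⟩, hvy.ne⟩
    obtain ⟨ε, h1, h2, h3, h4, -, h6⟩ := h.exists_tame_of_odd hv (Λ ⊔ edge v y)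
      (fun p q hpq => by
        rcases hedge p q hpq with h1 | ⟨rfl, rfl⟩ | ⟨rfl, rfl⟩
        exacts [hΛG _ _ h1, hvy, hvy.symm])
      (fun p q hpq hp hq => by
        rcases hedge p q hpq with h1 | ⟨rfl, rfl⟩ | ⟨rfl, rfl⟩
        exacts [crossing_avoiding_adj_reds _ _ h1 hp hq, hp.2 rfl, hq.2 rfl]) r
      K₀ (fun b hb => ((hK₀ b).1 hb).1) 1 ((ZMod.natCast_eq_one_iff_odd).2 hd) P hPs hPf
      (fun a b hab => Or.inl (hPa a b hab)) hPv
      hPK (fun _ => hvr) (fun a ha _ hP => (hreach a ha hP).mono le_sup_left)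
    refine h.false_of_full_star hv h1 K₀ hK₀ (fun b hb => h2 _ _ fun hb' => ?_) h3 h4 ?_ hd2
    · rcases hedge v b hb' with h1 | ⟨-, rfl⟩ | ⟨-, rfl⟩
      exacts [hΛv _ h1, hyB hb, hv hb]
    · exact (h6 rfl).add_odd ((Int.odd_coe_nat _).2 hd)
  have hsub : ∀ w, G.Adj v w → w ∈ B := fun w hw => by
    by_contra hwB
    exact hy ⟨w, hwB, hw⟩
  -- otherwise the edge to `b₀` is left out; `b₀` is then avoided as one value of the total at `v`
  have hKc : (K₀.erase b₀).card = K₀.card - 1 := Finset.card_erase_of_mem hb₀K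
  have hKe : Even (K₀.erase b₀).card := by
    rw [hKc]
    exact hd.tsub_odd odd_one
  obtain ⟨ε, h1, h2, h3, h4, h5, -⟩ := h.exists_tame_of_odd hv Λ hΛG crossing_avoiding_adj_reds r
    (K₀.erase b₀) (fun b hb => ((hK₀ b).1 (Finset.mem_of_mem_erase hb)).1) 0
    ((ZMod.natCast_eq_zero_iff_even).2 hKe) P hPs hPf hPa hPv
    (fun a b hab ha => Finset.mem_erase.2 ⟨fun e => hab.2 (e ▸ hb₀r), hPK a b hab ha⟩)
    (fun h => absurd rfl h) (fun a ha _ hP => hreach a ha hP)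
  have hε0 : ∀ q, ε v q = 0 := fun q => h2 _ _ (hΛv q)
  have hdeg : G.intDegree v = K₀.card := by
    rw [intDegree_eq_card]
    congr 2
    ext w
    simp only [Finset.mem_filter, Finset.mem_univ, true_and, K₀]
    exact ⟨fun hw => ⟨hsub w hw, hw⟩, fun hw => hw.2⟩
  by_cases h4K : 4 ≤ (K₀.erase b₀).card
  · exfalso
    obtain ⟨σ, hσ, hσs, hσ'⟩ := exists_star_signs_sum_ne (K₀.erase b₀)
      (fun b => 2 * G.intDegree b + ∑ c, ε b c - 2 * G.intDegree v - ∑ c, ε v c)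
      (2 * G.intDegree b₀ + ∑ c, ε b₀ c - 2 * G.intDegree v - ∑ c, ε v c) h4K
    obtain ⟨b, hb, hvb, he⟩ := h.conflict_signs hv h1 (K₀.erase b₀)
      (fun b hb => ⟨((hK₀ b).1 (Finset.mem_of_mem_erase hb)).1,
        ((hK₀ b).1 (Finset.mem_of_mem_erase hb)).2, hε0 b⟩) h3 h4
      ((h5 rfl).add ((Int.even_coe_nat _).2 hKe)) σ hσ
    by_cases hbb : b = b₀
    · subst hbb
      rw [if_neg (by simp)] at he
      exact hσs (by linarith)
    · have hbK : b ∈ K₀.erase b₀ := Finset.mem_erase.2 ⟨hbb, (hK₀ b).2 ⟨hb, hvb⟩⟩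
      rw [if_pos hbK] at he
      exact hσ' b hbK (by linarith)
  have hK3 : K₀.card = 3 := by
    obtain ⟨k, hk⟩ := hd
    omega
  have hdeg3 : G.intDegree v = 3 := by rw [hdeg, hK3]; rfl
  obtain ⟨b₁, b₂, h01, h02, h12, hN⟩ := exists_three_of_intDegree hdeg3 hvb₀
  have hm : ∀ b, b ∈ K₀.erase b₀ ↔ b = b₁ ∨ b = b₂ := by
    intro b
    rw [Finset.mem_erase, hK₀]
    constructor
    · rintro ⟨e, -, e'⟩
      exact ((hN b).1 e').resolve_left e
    · rintro (rfl | rfl)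
      · have := (hN b).2 (Or.inr (Or.inl rfl))
        exact ⟨h01.symm, hsub _ this, this⟩
      · have := (hN b).2 (Or.inr (Or.inr rfl))
        exact ⟨h02.symm, hsub _ this, this⟩
  obtain ⟨d0, d1, d2, -⟩ := h.sum_eq_zero_of_three hv h1 hε0 h01 h02 h12 hN hsub
    (h3 _ ((hm _).2 (Or.inl rfl))) (h3 _ ((hm _).2 (Or.inr rfl)))
    (fun b hb e1 e2 => h4 b hb fun hbK => ((hm b).1 hbK).elim e1 e2)
  refine ⟨hsub, hdeg3, fun w hw => ?_⟩
  rcases (hN w).1 hw with rfl | rfl | rfl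
  exacts [d0.trans hdeg3, d1.trans hdeg3, d2.trans hdeg3]

/-- A cubic red vertex `v` and another red vertex `x` with a common blue neighbour `b` cannot be
removed together without disconnecting the crossing graph: the edge from `b` to the one that is not
exceptional would carry a free sign. -/
theorem false_of_isCubicAt (h : G.IsObstruction B)
    (hc : ∀ a b, (G.crossing B).Reachable a b) {v x b r : V} (hv : v ∉ B) (hx : x ∉ B)
    (hxv : x ≠ v) (hX : G.IsCubicAt B v) (hvb : G.Adj v b) (hxb : G.Adj x b)
    (hr : ∀ a, a ≠ v → a ≠ x → ((G.crossing B).avoiding {v, x}).Reachable a r) : False := by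
  have hb : b ∈ B := hX.sub b hvb
  have hbr := hr b hvb.ne' hxb.ne'
  set Λ := (G.crossing B).avoiding {v, x} with hΛ
  have hΛG : ∀ p q, Λ.Adj p q → G.Adj p q := fun p q hpq => hpq.1.1
  have hΛR : ∀ z p q, Λ.Adj p q → p ∈ redsExcept B z → q ∉ redsExcept B z :=
    fun z p q hpq hp hq => hpq.1.2 ⟨fun h => absurd h hp.1, fun h => absurd h hq.1⟩
  have hedge : ∀ z p q, (Λ ⊔ edge z b).Adj p q →
      Λ.Adj p q ∨ (p = z ∧ q = b) ∨ (p = b ∧ q = z) := by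
    intro z p q hpq
    rw [sup_adj, edge_adj] at hpq
    tauto
  have hzr : ∀ z, G.Adj z b → (Λ ⊔ edge z b).Reachable z r := fun z hz => by
    refine Reachable.trans (Adj.reachable ?_) (hbr.mono le_sup_left)
    rw [sup_adj, edge_adj]
    exact Or.inr ⟨Or.inl ⟨rfl, rfl⟩, hz.ne⟩
  have hHG : ∀ z, G.Adj z b → ∀ p q, (Λ ⊔ edge z b).Adj p q → G.Adj p q := fun z hz p q hpq => by
    rcases hedge z p q hpq with h1 | ⟨rfl, rfl⟩ | ⟨rfl, rfl⟩
    exacts [hΛG _ _ h1, hz, hz.symm]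
  have hHR : ∀ z w p q, (Λ ⊔ edge z b).Adj p q → p ∈ redsExcept B w → q ∉ redsExcept B w :=
    fun z w p q hpq hp hq => by
      rcases hedge z p q hpq with h1 | ⟨rfl, rfl⟩ | ⟨rfl, rfl⟩
      exacts [hΛR w _ _ h1 hp hq, hq.1 hb, hp.1 hb]
  -- if `b` is the only blue neighbour of `x`, take `x` exceptional and toggle the edge `v b`
  by_cases hpriv : ∀ w ∈ B, G.Adj x w → w = b
  · obtain ⟨ε, h1, h2, -, h4, h5, -⟩ := h.exists_tame_of_odd hx (Λ ⊔ edge v b) (hHG v hvb)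
      (hHR v x) r ∅ (by simp) 0 (by simp) (fun _ _ => False) (by simp) (by simp) (by simp)
      (by simp) (by simp) (by simp) (fun a ha _ _ => by
        by_cases hav : a = v
        · subst hav; exact hzr _ hvb
        · exact (hr a hav ha).mono le_sup_left)
    have hε0 : ∀ q, ε x q = 0 := fun q => h2 _ _ fun hq => by
      rcases hedge v x q hq with h1 | ⟨e, -⟩ | ⟨e, -⟩
      exacts [h1.2.1 (by simp), hxv e, hxb.ne e]
    have hsx : ∑ q, ε x q = 0 := Finset.sum_eq_zero fun q _ => hε0 q
    have hsv : ∑ q, ε v q = ε v b := by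
      refine Finset.sum_eq_single b (fun q _ hq => h2 _ _ fun hq' => ?_) (by simp)
      rcases hedge v v q hq' with h1 | ⟨-, e⟩ | ⟨e, -⟩
      exacts [h1.2.1 (by simp), hq e, hvb.ne e]
    have hodd := h1.odd v ⟨hv, hxv.symm⟩
    rw [hsv] at hodd
    obtain ⟨k, hk⟩ := hodd
    obtain ⟨b₁, hb₁, hxb₁, he⟩ := h.conflict hx h1 (h5 rfl) (fun b hb => h4 b hb (by simp))
    obtain rfl := hpriv b₁ hb₁ hxb₁
    obtain ⟨ht, hts⟩ := isTameAt_toggle h1 hv hxv.symm hb hX.sub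
    obtain ⟨b₂, hb₂, hxb₂, he₂⟩ := h.conflict hx ht
      (by
        rw [hts x, if_neg hxv, if_neg hxb.ne, hsx]
        decide)
      (fun c hc => by
        rw [hts c, if_neg (show c ≠ v from fun e => hv (e ▸ hc)), zero_add]
        refine (h4 c hc (by simp)).add ?_
        split_ifs
        · rw [neg_mul]; exact (even_two_mul _).neg
        · exact Even.zero)
    obtain rfl := hpriv b₂ hb₂ hxb₂
    rw [hts x, hts b₂, if_neg hxv, if_neg hxb.ne, if_neg hvb.ne', if_pos rfl] at he₂
    omega
  -- otherwise `x` is cubic as well; take `v` exceptional and toggle the edge `x b`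
  · push Not at hpriv
    obtain ⟨w, hw, hxw, hwb⟩ := hpriv
    have hle : Λ ≤ (G.crossing B).avoiding {x} := avoiding_mono _ (by simp)
    have hXx : G.IsCubicAt B x := by
      refine h.isCubicAt_of_reachable hc hx (r := r) (fun a ha => Or.inl ?_) hb hw hwb hxb hxw
        (hbr.mono hle)
      by_cases hav : a = v
      · subst hav
        refine Reachable.trans (Adj.reachable ?_) (hbr.mono hle)
        exact ⟨⟨hvb, fun h => hv (h.2 hb)⟩, hxv.symm, hxb.ne'⟩
      · exact (hr a hav ha).mono hle
    obtain ⟨b₁, b₂, h01, h02, h12, hN⟩ := exists_three_of_intDegree hX.deg hvb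
    have hb₁ := hX.sub b₁ ((hN _).2 (Or.inr (Or.inl rfl)))
    have hb₂ := hX.sub b₂ ((hN _).2 (Or.inr (Or.inr rfl)))
    obtain ⟨ε, h1, h2, h3, h4, h5, -⟩ := h.exists_tame_of_odd hv (Λ ⊔ edge x b) (hHG x hxb)
      (hHR x v) r {b₁, b₂} (by
        intro c hc
        rcases Finset.mem_insert.1 hc with rfl | hc
        · exact hb₁
        · rw [Finset.mem_singleton.1 hc]; exact hb₂) 0
      (by rw [Finset.card_pair h12]; decide)
      (fun _ _ => False) (by simp) (by simp) (by simp)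
      (by simp) (by simp) (by simp) (fun a ha _ _ => by
        by_cases hax : a = x
        · subst hax; exact hzr _ hxb
        · exact (hr a ha hax).mono le_sup_left)
    have hε0 : ∀ q, ε v q = 0 := fun q => h2 _ _ fun hq => by
      rcases hedge x v q hq with h1 | ⟨e, -⟩ | ⟨e, -⟩
      exacts [h1.2.1 (by simp), hxv e.symm, hvb.ne e]
    have hsx : ∑ q, ε x q = ε x b := by
      refine Finset.sum_eq_single b (fun q _ hq => h2 _ _ fun hq' => ?_) (by simp)
      rcases hedge x x q hq' with h1 | ⟨-, e⟩ | ⟨e, -⟩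
      exacts [h1.2.1 (by simp), hq e, hxb.ne e]
    have hodd := h1.odd x ⟨hx, hxv⟩
    rw [hsx] at hodd
    obtain ⟨k, hk⟩ := hodd
    have hev : ∀ c ∈ B, c ≠ b₁ → c ≠ b₂ → Even (∑ q, ε c q) := fun c hc e1 e2 =>
      h4 c hc (by simp [e1, e2])
    obtain ⟨-, -, -, e1⟩ := h.sum_eq_zero_of_three hv h1 hε0 h01 h02 h12 hN hX.sub
      (h3 _ (by simp)) (h3 _ (by simp)) hev
    obtain ⟨ht, hts⟩ := isTameAt_toggle h1 hx hxv hb hXx.sub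
    have hx' : ∀ c ∈ B, c ≠ x := fun c hc e => hx (e ▸ hc)
    obtain ⟨-, -, -, e2⟩ := h.sum_eq_zero_of_three hv ht (fun q => by
        rw [hε0 q]
        simp [edgeFun, hxv.symm, hvb.ne]) h01 h02 h12 hN hX.sub
      (by rw [hts, if_neg (hx' _ hb₁), if_neg h01.symm, add_zero, add_zero]; exact h3 _ (by simp))
      (by rw [hts, if_neg (hx' _ hb₂), if_neg h02.symm, add_zero, add_zero]; exact h3 _ (by simp))
      (fun c hc e1 e2 => by
        rw [hts c, if_neg (hx' c hc), zero_add]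
        refine (hev c hc e1 e2).add ?_
        split_ifs
        · rw [neg_mul]; exact (even_two_mul _).neg
        · exact Even.zero)
    rw [hts, hts, hts, if_neg (hx' _ hb), if_neg (hx' _ hb₁), if_neg (hx' _ hb₂), if_pos rfl,
      if_neg h01.symm, if_neg h02.symm] at e2
    omega

end IsObstruction

/-! ### Distances in the crossing graph -/

theorem Reachable.exists_adj_dist {V : Type u} {H : SimpleGraph V} {a r : V}
    (h : H.Reachable a r) (ha : H.dist a r ≠ 0) : ∃ b, H.Adj a b ∧ H.dist b r + 1 = H.dist a r := by
  obtain ⟨w, hw⟩ := h.exists_walk_length_eq_dist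
  cases w with
  | nil => simp at ha
  | @cons _ b _ hab p =>
    refine ⟨b, hab, ?_⟩
    have h1 : H.dist b r ≤ p.length := dist_le p
    obtain ⟨q, hq⟩ := p.reachable.exists_walk_length_eq_dist
    have h2 := dist_le (Walk.cons hab q)
    simp only [Walk.length_cons] at hw h2
    omega

/-- Descending to the root `r` avoids every vertex that is at least as far away. -/
theorem avoiding_reachable_of_dist {V : Type u} {H : SimpleGraph V} {r : V}
    (hc : ∀ a, H.Reachable a r) (A : Set V) (a : V) (ha : a ∉ A)
    (hA : ∀ z ∈ A, H.dist a r ≤ H.dist z r) : (H.avoiding A).Reachable a r := by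
  induction hn : H.dist a r using Nat.strong_induction_on generalizing a with
  | _ n ih =>
    by_cases h0 : H.dist a r = 0
    · rw [(hc a).dist_eq_zero_iff.1 h0]
    · obtain ⟨b, hab, hb⟩ := (hc a).exists_adj_dist h0
      have hbA : b ∉ A := fun h => by
        have := hA b h
        omega
      exact Reachable.trans (Adj.reachable ⟨hab, ha, hbA⟩)
        (ih _ (by omega) b hbA (fun z hz => by have := hA z hz; omega) rfl)

theorem crossing_walk_even {V : Type u} {G : SimpleGraph V} {B : Set V} {a r : V}
    (w : (G.crossing B).Walk a r) (hr : r ∈ B) : Even w.length ↔ a ∈ B := by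
  induction w with
  | nil => simpa using hr
  | @cons a b r hab p ih =>
    have := ih hr
    have h2 := hab.2
    rw [Walk.length_cons, Nat.even_add_one, this]
    tauto

theorem crossing_dist_even {V : Type u} {G : SimpleGraph V} {B : Set V} {a r : V}
    (h : (G.crossing B).Reachable a r) (hr : r ∈ B) :
    Even ((G.crossing B).dist a r) ↔ a ∈ B := by
  obtain ⟨w, hw⟩ := h.exists_walk_length_eq_dist
  rw [← hw]
  exact crossing_walk_even w hr

theorem crossing_dist_adj {V : Type u} {G : SimpleGraph V} {B : Set V} {a b r : V}
    (h : (G.crossing B).Reachable a r) (hr : r ∈ B) (hab : (G.crossing B).Adj a b) :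
    (G.crossing B).dist b r = (G.crossing B).dist a r + 1 ∨
      (G.crossing B).dist b r + 1 = (G.crossing B).dist a r := by
  have hb : (G.crossing B).Reachable b r := hab.symm.reachable.trans h
  obtain ⟨w, hw⟩ := h.exists_walk_length_eq_dist
  obtain ⟨w', hw'⟩ := hb.exists_walk_length_eq_dist
  have h1 := dist_le (Walk.cons hab.symm w)
  have h2 := dist_le (Walk.cons hab w')
  have h3 := crossing_dist_even h hr
  have h4 := crossing_dist_even hb hr
  have h5 := hab.2
  simp only [Walk.length_cons] at h1 h2
  have : ¬ (G.crossing B).dist b r = (G.crossing B).dist a r := fun e => by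
    rw [e] at h4
    exact h5 (h3.symm.trans h4)
  omega

/-! ### Linked independent sets -/

/-- An independent set whose members are connected to each other by the crossing graph. -/
structure IsLinked {V : Type u} (G : SimpleGraph V) (B : Set V) : Prop where
  indep : ∀ a ∈ B, ∀ b ∈ B, ¬ G.Adj a b
  reach : ∀ a ∈ B, ∀ b ∈ B, (G.crossing B).Reachable a b

/-- A linked set that cannot be enlarged dominates the graph, so that its crossing graph is
connected. -/
theorem IsLinked.crossing_reachable {V : Type u} {G : SimpleGraph V} {B : Set V} {p : V}
    (h : G.IsLinked B) (hp : p ∈ B) (hG : ∀ a b, G.Reachable a b)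
    (hmax : ∀ z ∉ B, ¬ G.IsLinked (insert z B)) (a b : V) : (G.crossing B).Reachable a b := by
  have hdom : ∀ a, a ∉ B → ∃ b ∈ B, G.Adj a b := by
    by_contra hno
    push Not at hno
    obtain ⟨a, haB, ha⟩ := hno
    obtain ⟨w⟩ := hG p a
    obtain ⟨d, -, hd1, hd2⟩ := w.exists_boundary_dart {y | y ∈ B ∨ ∃ b ∈ B, G.Adj y b}
      (Or.inl hp) (fun h' => h'.elim haB fun ⟨b, hb, hab⟩ => ha b hb hab)
    have hadj := d.adj
    generalize d.fst = y at hd1 hadj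
    generalize d.snd = z at hd2 hadj
    simp only [Set.mem_ofPred_eq, not_or, not_exists, not_and] at hd1 hd2
    obtain ⟨hzB, hz⟩ := hd2
    have hyB : y ∉ B := fun hy => hz y hy hadj.symm
    obtain ⟨b, hb, hyb⟩ := hd1.resolve_left hyB
    have hle : G.crossing B ≤ G.crossing (insert z B) := by
      intro c d hcd
      refine ⟨hcd.1, fun h' => ?_⟩
      have h1 : c ≠ z := by
        rintro rfl
        have : d ∈ B := by
          by_contra hd
          exact hcd.2 ⟨fun h => absurd h hzB, fun h => absurd h hd⟩
        exact hz d this hcd.1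
      have h2 : d ≠ z := by
        rintro rfl
        have : c ∈ B := by
          by_contra hd
          exact hcd.2 ⟨fun h => absurd h hd, fun h => absurd h hzB⟩
        exact hz c this hcd.1.symm
      simp only [Set.mem_insert_iff, h1, h2, false_or] at h'
      exact hcd.2 h'
    have hyz : y ∉ insert z B := by
      simp only [Set.mem_insert_iff, not_or]
      exact ⟨hadj.ne, hyB⟩
    have hzb : ∀ c ∈ B, (G.crossing (insert z B)).Reachable z c := fun c hc => by
      refine Reachable.trans (Adj.reachable (v := y) ⟨hadj.symm, fun h => hyz (h.1 (by simp))⟩) ?_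
      refine Reachable.trans (Adj.reachable (v := b) ⟨hyb, fun h => hyz (h.2 (by simp [hb]))⟩) ?_
      exact (h.reach b hb c hc).mono hle
    refine hmax z hzB ⟨?_, ?_⟩
    · rintro c (rfl | hc) d (rfl | hd) hcd
      · exact hcd.ne rfl
      · exact hz d hd hcd
      · exact hz c hc hcd.symm
      · exact h.indep c hc d hd hcd
    · rintro c (rfl | hc) d (rfl | hd)
      · exact Reachable.refl _
      · exact hzb d hd
      · exact (hzb c hc).symm
      · exact (h.reach c hc d hd).mono hle
  have key : ∀ a, (G.crossing B).Reachable a p := fun a => by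
    by_cases ha : a ∈ B
    · exact h.reach a ha p hp
    · obtain ⟨b, hb, hab⟩ := hdom a ha
      exact Reachable.trans (Adj.reachable ⟨hab, fun h => ha (h.2 hb)⟩) (h.reach b hb p hp)
  exact (key a).trans (key b).symm

theorem crossing_adj_of_mem {V : Type u} {G : SimpleGraph V} {B : Set V} {a b : V}
    (h : G.Adj a b) (ha : a ∈ B) (hb : b ∉ B) : (G.crossing B).Adj a b :=
  ⟨h, fun h' => hb (h'.1 ha)⟩

theorem exists_blue_adj {V : Type u} {G : SimpleGraph V} {B : Set V} {p : V} (hp : p ∈ B)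
    (hc : ∀ a b, (G.crossing B).Reachable a b) {a : V} (ha : a ∉ B) : ∃ b ∈ B, G.Adj a b := by
  obtain ⟨w⟩ := hc a p
  cases w with
  | nil => exact absurd hp ha
  | @cons _ b _ hab _ =>
    refine ⟨b, ?_, hab.1⟩
    by_contra hb
    exact hab.2 ⟨fun h => absurd h ha, fun h => absurd h hb⟩

namespace IsObstruction

/-- In a linked set of maximum size, a blue vertex at maximum distance from the root has at most
one private red neighbour: two of them could replace it. -/
theorem private_unique {V : Type u} [Fintype V] {G : SimpleGraph V} {B : Finset V}
    (h : G.IsObstruction (B : Set V)) (hc : ∀ a b, (G.crossing (B : Set V)).Reachable a b)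
    (hmax : ∀ B' : Finset V, G.IsLinked (B' : Set V) → B'.card ≤ B.card)
    (hdeg : ∀ a b, ∃ b', G.Adj a b' ∧ b' ≠ b) {r c u u' : V} (hr : r ∈ B) (hcB : c ∈ B)
    (hfar : ∀ b ∈ B, (G.crossing (B : Set V)).dist b r ≤ (G.crossing (B : Set V)).dist c r)
    (hu : u ∉ B) (hu' : u' ∉ B) (huc : G.Adj u c) (huc' : G.Adj u' c)
    (hpriv : ∀ w ∈ B, G.Adj u w → w = c) (hpriv' : ∀ w ∈ B, G.Adj u' w → w = c) : u = u' := by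
  by_contra hne
  have huu' : ¬ G.Adj u u' := fun ha => h.private_not_adj hc hu hcB huc hpriv ha huc'.symm
  set Λ := G.crossing (B : Set V) with hΛ
  have hdist : ∀ u, u ∉ B → (∀ w ∈ B, G.Adj u w → w = c) → Λ.dist c r ≤ Λ.dist u r := by
    intro u hu hpriv
    have h0 : Λ.dist u r ≠ 0 := fun h0 => hu ((hc u r).dist_eq_zero_iff.1 h0 ▸ hr)
    obtain ⟨w, huw, hw⟩ := (hc u r).exists_adj_dist h0
    have hwB : w ∈ B := by
      by_contra hwB
      exact huw.2 ⟨fun h => absurd h hu, fun h => absurd h hwB⟩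
    rw [hpriv w hwB huw.1] at hw
    omega
  let B' : Finset V := insert u (insert u' (B.erase c))
  have hB'm : ∀ a, a ∈ B' ↔ a = u ∨ a = u' ∨ (a ≠ c ∧ a ∈ B) := by simp [B']
  have hcard : B'.card = B.card + 1 := by
    have h1 : u' ∉ B.erase c := fun h => hu' (Finset.mem_of_mem_erase h)
    have h2 : u ∉ insert u' (B.erase c) := by
      simp only [Finset.mem_insert, Finset.mem_erase, not_or]
      exact ⟨hne, fun h => hu h.2⟩
    rw [Finset.card_insert_of_notMem h2, Finset.card_insert_of_notMem h1,
      Finset.card_erase_of_mem hcB]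
    have := Finset.card_pos.2 ⟨c, hcB⟩
    omega
  have hle : Λ.avoiding {c, u, u'} ≤ G.crossing (B' : Set V) := by
    intro a b hab
    have ha : a ∈ B' ↔ a ∈ B := by
      have := hab.2.1
      simp only [Set.mem_insert_iff, Set.mem_singleton_iff, not_or] at this
      rw [hB'm]; tauto
    have hb : b ∈ B' ↔ b ∈ B := by
      have := hab.2.2
      simp only [Set.mem_insert_iff, Set.mem_singleton_iff, not_or] at this
      rw [hB'm]; tauto
    exact ⟨hab.1.1, fun h' => hab.1.2 (ha.symm.trans (h'.trans hb))⟩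
  have hold : ∀ b, b ≠ c → b ∈ B → (G.crossing (B' : Set V)).Reachable b r := by
    intro b hbc hb
    refine (avoiding_reachable_of_dist (fun a => hc a r) {c, u, u'} b ?_ ?_).mono hle
    · simp only [Set.mem_insert_iff, Set.mem_singleton_iff, not_or]
      exact ⟨hbc, fun e => hu (e ▸ hb), fun e => hu' (e ▸ hb)⟩
    · rintro z (rfl | rfl | rfl)
      · exact hfar b hb
      · exact (hfar b hb).trans (hdist _ hu hpriv)
      · exact (hfar b hb).trans (hdist _ hu' hpriv')
  have hnew : ∀ z, z ∈ B' → z ∉ B → G.Adj z c → (∀ w ∈ B, G.Adj z w → w = c) →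
      ¬ G.Adj z u → ¬ G.Adj z u' → (G.crossing (B' : Set V)).Reachable z r := by
    intro z hzB' hz hzc hp hzu hzu'
    obtain ⟨y, hzy, hyc⟩ := hdeg z c
    have hyB : y ∉ B := fun hy => hyc (hp y hy hzy)
    obtain ⟨b, hb, hyb⟩ := exists_blue_adj (p := c) hcB hc hyB
    have hbc : b ≠ c := by
      rintro rfl
      exact h.private_not_adj hc hz hcB hzc hp hzy hyb.symm
    have hyB' : y ∉ B' := by
      rw [hB'm]
      rintro (rfl | rfl | e)
      exacts [hzu hzy, hzu' hzy, hyB e.2]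
    have hbB' : b ∈ B' := (hB'm b).2 (Or.inr (Or.inr ⟨hbc, hb⟩))
    exact ((crossing_adj_of_mem (B := (B' : Set V)) hzy hzB' hyB').reachable.trans
      (crossing_adj_of_mem (B := (B' : Set V)) hyb.symm hbB' hyB').symm.reachable).trans
      (hold b hbc hb)
  have hall : ∀ a ∈ B', (G.crossing (B' : Set V)).Reachable a r := by
    intro a ha
    rcases (hB'm a).1 ha with rfl | rfl | ⟨e, ha'⟩
    · exact hnew _ ha hu huc hpriv (G.loopless.irrefl _) huu'
    · exact hnew _ ha hu' huc' hpriv' (fun e => huu' e.symm) (G.loopless.irrefl _)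
    · exact hold a e ha'
  have hlink : G.IsLinked (B' : Set V) := by
    refine ⟨fun a ha b hb hab => ?_, fun a ha b hb => (hall a ha).trans (hall b hb).symm⟩
    rcases (hB'm a).1 ha with rfl | rfl | ⟨e, ha'⟩ <;>
      rcases (hB'm b).1 hb with rfl | rfl | ⟨e', hb'⟩
    · exact hab.ne rfl
    · exact huu' hab
    · exact e' (hpriv b hb' hab)
    · exact huu' hab.symm
    · exact hab.ne rfl
    · exact e' (hpriv' b hb' hab)
    · exact e (hpriv a ha' hab.symm)
    · exact e (hpriv' a ha' hab.symm)
    · exact h.indep a ha' b hb' hab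
  have := hmax B' hlink
  omega

/-- No obstruction lives on a linked set of maximum size in a graph of minimum degree at least
`2`: a breadth-first search tree of the crossing graph has a red vertex near its bottom that can be
made exceptional. -/
theorem false_of_maximum {V : Type u} [Fintype V] {G : SimpleGraph V} {B : Finset V}
    (h : G.IsObstruction (B : Set V)) (hc : ∀ a b, (G.crossing (B : Set V)).Reachable a b)
    (hmax : ∀ B' : Finset V, G.IsLinked (B' : Set V) → B'.card ≤ B.card)
    (hdeg : ∀ a b, ∃ b', G.Adj a b' ∧ b' ≠ b) {r : V} (hr : r ∈ B) : False := by
  set Λ := G.crossing (B : Set V) with hΛ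
  obtain ⟨t, -, ht⟩ := Finset.exists_max_image univ (fun a => Λ.dist a r) ⟨r, mem_univ r⟩
  replace ht : ∀ a, Λ.dist a r ≤ Λ.dist t r := fun a => ht a (mem_univ a)
  have hdesc : ∀ (A : Set V) (a : V), a ∉ A → (∀ z ∈ A, Λ.dist a r ≤ Λ.dist z r) →
      (Λ.avoiding A).Reachable a r :=
    avoiding_reachable_of_dist (fun a => hc a r)
  have hpar : ∀ a, Even (Λ.dist a r) ↔ a ∈ B := fun a => crossing_dist_even (hc a r) hr
  have hadj : ∀ {a b}, Λ.Adj a b → Λ.dist b r = Λ.dist a r + 1 ∨ Λ.dist b r + 1 = Λ.dist a r :=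
    fun {a b} hab => crossing_dist_adj (hc a r) hr hab
  have hup : ∀ a, a ≠ r → ∃ b, Λ.Adj a b ∧ Λ.dist b r + 1 = Λ.dist a r := fun a ha =>
    (hc a r).exists_adj_dist fun h0 => ha ((hc a r).dist_eq_zero_iff.1 h0)
  have hΛb : ∀ {a w}, a ∈ B → G.Adj a w → Λ.Adj a w := fun {a w} ha haw =>
    crossing_adj_of_mem haw ha fun hw => h.indep a ha w hw haw
  have hdeg2 : ∀ a, ∃ b b', G.Adj a b ∧ G.Adj a b' ∧ b ≠ b' := fun a => by
    obtain ⟨b, hb, -⟩ := hdeg a a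
    obtain ⟨b', hb', hne⟩ := hdeg a b
    exact ⟨b, b', hb, hb', hne.symm⟩
  have hnr : ∀ {a}, a ∉ B → a ≠ r := fun {a} ha e => ha (e ▸ hr)
  have hred : ∀ {a b}, Λ.Adj a b → a ∈ B → b ∉ B := fun {a b} hab ha hb => hab.2 ⟨fun _ => hb, fun _ => ha⟩
  have hblue : ∀ {a b}, Λ.Adj a b → a ∉ B → b ∈ B := fun {a b} hab ha => by
    by_contra hb
    exact hab.2 ⟨fun h => absurd h ha, fun h => absurd h hb⟩
  -- a deepest vertex that is blue: two of its neighbours can be removed together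
  by_cases htB : t ∈ B
  · obtain ⟨v, x, htv, htx, hvx⟩ := hdeg2 t
    have hlev : ∀ a w, Λ.dist a r = Λ.dist t r → a ∈ B → G.Adj a w →
        Λ.dist w r + 1 = Λ.dist t r := fun a w hat haB haw => by
      have h1 := hadj (hΛb haB haw)
      have h2 := ht w
      omega
    have hv := hlev t v rfl htB htv
    have hx := hlev t x rfl htB htx
    have hvB : v ∉ B := hred (hΛb htB htv) htB
    have hxB : x ∉ B := hred (hΛb htB htx) htB
    have hlow : ∀ a, Λ.dist a r ≠ Λ.dist t r → Λ.dist a r ≤ Λ.dist v r := fun a ha => by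
      have := ht a
      omega
    have htop : ∀ a, Λ.dist a r = Λ.dist t r → a ∈ B := fun a ha => by
      rw [← hpar, ha, hpar]; exact htB
    obtain ⟨b₀, hvb₀, hb₀⟩ := hup v (hnr hvB)
    have hX : G.IsCubicAt (B : Set V) v := by
      refine h.isCubicAt_of_reachable hc hvB (r := r) (fun a ha => Or.inl ?_) (hblue hvb₀ hvB) htB
        (fun e => by rw [← e] at hb₀; omega) hvb₀.1 htv.symm
        (hdesc {v} b₀ (by simpa using hvb₀.ne') (by rintro z rfl; omega))
      by_cases hat : Λ.dist a r = Λ.dist t r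
      · obtain ⟨w, haw, hwv⟩ := hdeg a v
        have hw := hlev a w hat (htop a hat) haw
        refine Reachable.trans (Adj.reachable ⟨hΛb (htop a hat) haw, ha, hwv⟩) ?_
        exact hdesc {v} w hwv (by rintro z rfl; omega)
      · exact hdesc {v} a ha (by rintro z rfl; exact hlow a hat)
    refine h.false_of_isCubicAt hc hvB hxB hvx.symm hX htv.symm htx.symm (r := r)
      (fun a hav hax => ?_)
    have hdesc' : ∀ a, a ≠ v → a ≠ x → Λ.dist a r ≤ Λ.dist v r →
        (Λ.avoiding {v, x}).Reachable a r := fun a hav hax hle =>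
      hdesc {v, x} a (by simp [hav, hax]) (by rintro z (rfl | rfl) <;> omega)
    by_cases hat : Λ.dist a r = Λ.dist t r
    · obtain ⟨w, haw, hwv, hwx⟩ : ∃ w, G.Adj a w ∧ w ≠ v ∧ w ≠ x := by
        by_cases hadjv : G.Adj a v
        · obtain ⟨b₁, b₂, h1, h2, h3, hN⟩ :=
            exists_three_of_intDegree (hX.deg_nbr a hadjv.symm) hadjv
          by_cases hbx : b₁ = x
          · exact ⟨b₂, (hN _).2 (Or.inr (Or.inr rfl)), h2.symm, fun e => h3 (hbx.trans e.symm)⟩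
          · exact ⟨b₁, (hN _).2 (Or.inr (Or.inl rfl)), h1.symm, hbx⟩
        · obtain ⟨w, haw, hwx⟩ := hdeg a x
          exact ⟨w, haw, fun e => hadjv (e ▸ haw), hwx⟩
      have hw := hlev a w hat (htop a hat) haw
      refine Reachable.trans (Adj.reachable ⟨hΛb (htop a hat) haw, ?_, ?_⟩)
        (hdesc' w hwv hwx (by omega)) <;> simp [*]
    · exact hdesc' a hav hax (hlow a hat)
  -- the deepest vertex is red
  obtain ⟨c, htc, hct⟩ := hup t (hnr htB)
  have hcB : c ∈ B := hblue htc htB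
  have hbl : ∀ b ∈ B, Λ.dist b r ≤ Λ.dist c r := fun b hb => by
    have h1 := ht b
    have h2 : Λ.dist b r ≠ Λ.dist t r := fun e => htB ((hpar t).1 (e ▸ (hpar b).2 hb))
    omega
  -- depth one: all red vertices are adjacent to the root, the only blue vertex
  by_cases hcr : c = r
  · have hBr : ∀ b ∈ B, b = r := fun b hb => by
      have h1 := hbl b hb
      rw [hcr, dist_self] at h1
      exact (hc b r).dist_eq_zero_iff.1 (by omega)
    subst hcr
    obtain ⟨y, hty, hyc⟩ := hdeg t c
    have hyB : y ∉ B := fun hy => hyc (hBr y hy)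
    obtain ⟨b, hb, hyb⟩ := exists_blue_adj (p := c) hcB hc hyB
    rw [hBr b hb] at hyb
    exact h.private_not_adj hc htB hcB htc.1 (fun w hw _ => hBr w hw) hty hyb.symm
  obtain ⟨x, hcx, hxc⟩ := hup c hcr
  have hxB : x ∉ B := hred hcx hcB
  have hxt : x ≠ t := fun e => by rw [e] at hxc; omega
  have hredlev : ∀ a w, a ∈ B → Λ.dist a r = Λ.dist c r → G.Adj a w →
      Λ.dist w r = Λ.dist t r ∨ Λ.dist w r = Λ.dist x r := fun a w ha hac haw => by
    have := hadj (hΛb ha haw)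
    omega
  -- a blue vertex just above the bottom with no second way up forms a small pair
  have hsmall : ∀ a ∈ B, Λ.dist a r = Λ.dist c r →
      (∀ w, G.Adj a w → Λ.dist w r = Λ.dist x r → w = x) → ∃ y, G.IsSmallPair (B : Set V) x a y := by
    intro a ha hac hw
    have har : a ≠ r := fun e => by
      rw [e, dist_self] at hac
      omega
    obtain ⟨x', hax', hx'⟩ := hup a har
    obtain rfl := hw x' hax'.1 (by omega)
    have hpriv : ∀ y, G.Adj a y → y ≠ x' → ∀ b ∈ B, G.Adj y b → b = a := by
      intro y hay hyx b hb hyb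
      by_contra hba
      have hyt : Λ.dist y r = Λ.dist t r :=
        (hredlev a y ha hac hay).resolve_right fun e => hyx (hw y hay e)
      have hyB : y ∉ B := hred (hΛb ha hay) ha
      have hX : G.IsCubicAt (B : Set V) y :=
        h.isCubicAt_of_reachable hc hyB (r := r)
          (fun z hz => Or.inl (hdesc {y} z hz (by rintro w rfl; rw [hyt]; exact ht z)))
          ha hb hba hay.symm hyb (hdesc {y} a hay.ne (by rintro w rfl; rw [hyt]; exact ht a))
      obtain ⟨b₁, b₂, h1, h2, h3, hN⟩ :=
        exists_three_of_intDegree (hX.deg_nbr a hay.symm) hay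
      obtain ⟨z, haz, hzy, hzx⟩ : ∃ z, G.Adj a z ∧ z ≠ y ∧ z ≠ x' := by
        by_cases hbx : b₁ = x'
        · exact ⟨b₂, (hN _).2 (Or.inr (Or.inr rfl)), h2.symm, fun e => h3 (hbx.trans e.symm)⟩
        · exact ⟨b₁, (hN _).2 (Or.inr (Or.inl rfl)), h1.symm, hbx⟩
      have hzt : Λ.dist z r = Λ.dist t r :=
        (hredlev a z ha hac haz).resolve_right fun e => hzx (hw z haz e)
      refine h.false_of_isCubicAt hc hyB (hred (hΛb ha haz) ha) hzy hX hay.symm haz.symm (r := r)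
        (fun e he1 he2 => hdesc {y, z} e (by simp [he1, he2]) ?_)
      rintro w (rfl | rfl)
      · rw [hyt]; exact ht e
      · rw [hzt]; exact ht e
    obtain ⟨y, hay, hyx⟩ := hdeg a x'
    have hyB : y ∉ B := hred (hΛb ha hay) ha
    refine ⟨y, ha, hax'.1.symm, hyB, hyx, hay.symm, fun w haw => ?_, hpriv y hay hyx⟩
    by_cases hwx : w = x'
    · exact Or.inl hwx
    · exact Or.inr (h.private_unique hc hmax hdeg hr ha
        (fun b hb => (hbl b hb).trans hac.ge) (hred (hΛb ha haw) ha) hyB haw.symm hay.symm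
        (hpriv w haw hwx) (hpriv y hay hyx))
  -- everything above the bottom two levels avoids `x`
  have hlow : ∀ (A : Set V) a, a ∉ A → (∀ z ∈ A, Λ.dist x r ≤ Λ.dist z r) →
      Λ.dist a r ≤ Λ.dist x r → (Λ.avoiding A).Reachable a r := fun A a ha hA hax =>
    hdesc A a ha fun z hz => hax.trans (hA z hz)
  have hcase : ∀ a, Λ.dist a r ≤ Λ.dist x r ∨ (a ∈ B ∧ Λ.dist a r = Λ.dist c r) ∨
      (a ∉ B ∧ Λ.dist a r = Λ.dist t r) := by
    intro a
    have h1 := ht a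
    by_cases ha : a ∈ B
    · have h2 := hbl a ha
      have h3 := (hpar a).2 ha
      have h4 := (hpar c).2 hcB
      by_cases h5 : Λ.dist a r = Λ.dist c r
      · exact Or.inr (Or.inl ⟨ha, h5⟩)
      · left; omega
    · have h3 : ¬ Even (Λ.dist a r) := fun e => ha ((hpar a).1 e)
      have h4 := (hpar c).2 hcB
      by_cases h5 : Λ.dist a r = Λ.dist t r
      · exact Or.inr (Or.inr ⟨ha, h5⟩)
      · have h6 : Λ.dist a r ≠ Λ.dist c r := fun e => h3 (e ▸ h4)
        left; omega
  have hmid : ∀ a ∈ B, Λ.dist a r = Λ.dist c r →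
      (Λ.avoiding {x}).Reachable a r ∨ ∃ y, G.IsSmallPair (B : Set V) x a y := by
    intro a ha hac
    by_cases hw : ∀ w, G.Adj a w → Λ.dist w r = Λ.dist x r → w = x
    · exact Or.inr (hsmall a ha hac hw)
    · push Not at hw
      obtain ⟨w, haw, hwx, hne⟩ := hw
      left
      refine Reachable.trans (Adj.reachable ⟨hΛb ha haw, fun e => hxB (e ▸ ha), hne⟩) ?_
      exact hlow {x} w hne (by rintro z rfl; rfl) hwx.le
  obtain ⟨b₀, hxb₀, hb₀⟩ := hup x (hnr hxB)
  have hX : G.IsCubicAt (B : Set V) x := by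
    refine h.isCubicAt_of_reachable hc hxB (r := r) (fun a hax => ?_) (hblue hxb₀ hxB) hcB
      (fun e => by rw [← e] at hb₀; omega) hxb₀.1 hcx.1.symm
      (hlow {x} b₀ hxb₀.ne' (by rintro z rfl; rfl) (by omega))
    rcases hcase a with h1 | ⟨ha, h1⟩ | ⟨ha, h1⟩
    · exact Or.inl (hlow {x} a hax (by rintro z rfl; rfl) h1)
    · exact (hmid a ha h1).imp id fun ⟨y, hy⟩ => ⟨y, Or.inl hy⟩
    · obtain ⟨a', haa', ha'⟩ := hup a (hnr ha)
      have ha'B := hblue haa' ha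
      rcases hmid a' ha'B (by omega) with h2 | ⟨y, hy⟩
      · exact Or.inl (Reachable.trans (Adj.reachable ⟨haa', hax, fun e => hxB (e ▸ ha'B)⟩) h2)
      · have : a = y := (hy.nbr a haa'.1.symm).resolve_left hax
        subst this
        exact Or.inr ⟨a', Or.inr hy⟩
  have hnosmall : ∀ a y, ¬ G.IsSmallPair (B : Set V) x a y := fun a y hs => by
    obtain ⟨b₁, b₂, h1, h2, h3, hN⟩ :=
      exists_three_of_intDegree (hX.deg_nbr a hs.adj) hs.adj.symm
    have e1 := (hs.nbr b₁ ((hN _).2 (Or.inr (Or.inl rfl)))).resolve_left h1.symm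
    have e2 := (hs.nbr b₂ ((hN _).2 (Or.inr (Or.inr rfl)))).resolve_left h2.symm
    exact h3 (e1.trans e2.symm)
  have hxlt : ∀ z ∈ ({x, t} : Set V), Λ.dist x r ≤ Λ.dist z r := by
    rintro z (rfl | rfl)
    · exact le_rfl
    · exact ht x
  have hmid' : ∀ a ∈ B, Λ.dist a r = Λ.dist c r → (Λ.avoiding {x, t}).Reachable a r := by
    intro a ha hac
    by_cases hw : ∀ w, G.Adj a w → Λ.dist w r = Λ.dist x r → w = x
    · obtain ⟨y, hy⟩ := hsmall a ha hac hw
      exact absurd hy (hnosmall a y)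
    · push Not at hw
      obtain ⟨w, haw, hwx, hne⟩ := hw
      have hwt : w ≠ t := fun e => by rw [e] at hwx; omega
      have hax : a ≠ x := fun e => hxB (e ▸ ha)
      have hat : a ≠ t := fun e => htB (e ▸ ha)
      refine Reachable.trans (Adj.reachable ⟨hΛb ha haw, by simp [hax, hat], by simp [hne, hwt]⟩) ?_
      exact hlow _ w (by simp [hne, hwt]) hxlt hwx.le
  refine h.false_of_isCubicAt hc hxB htB hxt.symm hX hcx.1.symm htc.1 (r := r)
    (fun a hax hat => ?_)
  rcases hcase a with h1 | ⟨ha, h1⟩ | ⟨ha, h1⟩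
  · exact hlow _ a (by simp [hax, hat]) hxlt h1
  · exact hmid' a ha h1
  · obtain ⟨a', haa', ha'⟩ := hup a (hnr ha)
    have ha'B := hblue haa' ha
    have h1 : a' ≠ x := fun e => hxB (e ▸ ha'B)
    have h2 : a' ≠ t := fun e => htB (e ▸ ha'B)
    exact Reachable.trans (Adj.reachable ⟨haa', by simp [hax, hat], by simp [h1, h2]⟩)
      (hmid' a' ha'B (by omega))

end IsObstruction

/-! ### Finite connected graphs -/

/-- With an even number of red vertices there is an edge set of the crossing graph that is odd exactly
at the red vertices, and no vertex has to be exceptional. -/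
theorem hasGoodPerturbation_of_even {V : Type u} [Fintype V] {G : SimpleGraph V} {B : Set V}
    {r : V} (hB : ∀ a ∈ B, ∀ b ∈ B, ¬ G.Adj a b) (hc : ∀ a b, (G.crossing B).Reachable a b)
    (he : ∑ a : V, (if a ∈ B then (0 : ZMod 2) else 1) = 0) : G.HasGoodPerturbation := by
  obtain ⟨θ, hθ, H⟩ := G.exists_residues Bᶜ
  obtain ⟨x, h1, h2, h3⟩ := exists_join (G.crossing B) r _ (fun a _ => hc a r) he
  obtain ⟨ε, hε, hx⟩ := exists_isTame G Bᶜ hθ x h1 (fun p q hpq => h2 p q fun h => hpq h.1)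
    (fun p hp q hq => h2 p q fun h => h.2 ⟨fun h => absurd h hp, fun h => absurd h hq⟩)
    (fun p hp => by rw [h3, if_neg hp])
  refine H ε hε (fun a ha => ?_) (fun a ha b hb hab => ?_)
  · rw [← intCast_zmod_two_eq_zero, Int.cast_sum, Finset.sum_congr rfl fun q _ => hx a q, h3,
      if_pos (Set.notMem_compl_iff.1 ha)]
  · exact absurd hab (hB a (Set.notMem_compl_iff.1 ha) b (Set.notMem_compl_iff.1 hb))

theorem isLinked_singleton {V : Type u} (G : SimpleGraph V) (p : V) : G.IsLinked {p} where
  indep := by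
    rintro a rfl b rfl h
    exact h.ne rfl
  reach := by
    rintro a rfl b rfl
    exact Reachable.refl _

theorem isObstruction_of_not {V : Type u} [Fintype V] {G : SimpleGraph V} {B : Set V}
    {r : V} (hB : ∀ a ∈ B, ∀ b ∈ B, ¬ G.Adj a b) (hc : ∀ a b, (G.crossing B).Reachable a b)
    (hno : ¬ G.HasGoodPerturbation) : G.IsObstruction B := by
  refine ⟨hB, ?_, hno⟩
  have h1 : ∑ a : V, (if a ∈ B then (0 : ZMod 2) else 1) ≠ 0 := fun he =>
    hno (hasGoodPerturbation_of_even (r := r) hB hc he)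
  generalize ∑ a : V, (if a ∈ B then (0 : ZMod 2) else 1) = n at h1
  revert n; decide

/-- A linked set of maximum size among those satisfying `P`, for a property `P` that is preserved
by insertions. -/
theorem exists_maximum_linked {V : Type u} [Fintype V] {G : SimpleGraph V}
    (hG : ∀ a b, G.Reachable a b) (P : Finset V → Prop)
    (hP : ∀ B z, P B → P (insert z B)) {B₀ : Finset V} (hB₀ : G.IsLinked (B₀ : Set V))
    (hPB₀ : P B₀) (hne : ∀ B, P B → B.Nonempty) :
    ∃ B : Finset V, G.IsLinked (B : Set V) ∧ P B ∧
      (∀ B' : Finset V, G.IsLinked (B' : Set V) → P B' → B'.card ≤ B.card) ∧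
      ∀ a b, (G.crossing (B : Set V)).Reachable a b := by
  obtain ⟨B, hB, hmax⟩ := Finset.exists_max_image
    (univ.filter fun B : Finset V => G.IsLinked (B : Set V) ∧ P B) Finset.card
    ⟨B₀, by simp [hB₀, hPB₀]⟩
  simp only [Finset.mem_filter, Finset.mem_univ, true_and] at hB hmax
  obtain ⟨p, hp⟩ := hne B hB.2
  refine ⟨B, hB.1, hB.2, fun B' h1 h2 => hmax B' ⟨h1, h2⟩, ?_⟩
  refine hB.1.crossing_reachable (p := p) hp hG fun z hz hl => ?_
  have := hmax (insert z B) ⟨by rwa [Finset.coe_insert], hP B z hB.2⟩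
  rw [Finset.card_insert_of_notMem hz] at this
  omega

/-- A leaf can be made exceptional: its degree is too small for a conflict. -/
theorem IsObstruction.false_of_leaf {V : Type u} [Fintype V] {G : SimpleGraph V} {B : Set V}
    (h : G.IsObstruction B) (hc : ∀ a b, (G.crossing B).Reachable a b) {l p q : V} (hp : p ∈ B)
    (hlp : G.Adj l p) (hl : ∀ w, G.Adj l w → w = p) (hpq : G.Adj p q) (hql : q ≠ l) : False := by
  have hlB : l ∉ B := fun hl => h.indep l hl p hp hlp
  obtain ⟨ε, ht, hε0, hεB⟩ := h.exists_tame_zero hlB p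
    (reachable_avoiding_of_private hc hlB hp hlp fun w _ hw => hl w hw)
  have hs : ∑ q, ε l q = 0 := Finset.sum_eq_zero fun q _ => hε0 q
  obtain ⟨b, hb, hlb, he⟩ := h.conflict hlB ht (by rw [hs]; exact Even.zero) hεB
  obtain rfl := hl b hlb
  have hdl : G.intDegree l = 1 := by
    rw [intDegree_eq_card]
    have : (univ.filter fun w => G.Adj l w) = {b} := by
      ext w
      simp only [Finset.mem_filter, Finset.mem_univ, true_and, Finset.mem_singleton]
      exact ⟨hl w, fun e => e ▸ hlp⟩
    rw [this]; simp
  have hdb : 2 ≤ G.intDegree b := by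
    rw [intDegree_eq_card]
    have : ({l, q} : Finset V) ⊆ univ.filter fun w => G.Adj b w := by
      intro w hw
      rw [Finset.mem_filter]
      rcases Finset.mem_insert.1 hw with rfl | hw
      · exact ⟨mem_univ _, hlp.symm⟩
      · rw [Finset.mem_singleton.1 hw]; exact ⟨mem_univ _, hpq⟩
    have h2 := Finset.card_le_card this
    rw [Finset.card_pair hql.symm] at h2
    exact_mod_cast h2
  have hle : - G.intDegree b + 1 ≤ ∑ q, ε b q := by
    have : - G.intDegree b + 1 = ∑ q, ((if G.Adj b q then -1 else 0) + if q = l then 1 else 0) := by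
      rw [Finset.sum_add_distrib, intDegree, ← Finset.sum_neg_distrib]
      congr 1
      · exact Finset.sum_congr rfl fun q _ => by split_ifs <;> rfl
      · simp
    rw [this]
    refine Finset.sum_le_sum fun q _ => ?_
    by_cases h1 : q = l
    · subst h1
      rw [ht.symm, hε0]
      simp [hlp.symm]
    · by_cases h2 : G.Adj b q
      · simp only [h1, h2, if_true, if_false, add_zero]
        exact (abs_le.1 (ht.le b q)).1
      · rw [ht.supp b q h2]
        simp [h1, h2]
  rw [hs, hdl] at he
  omega

theorem hasGoodPerturbation_of_connected {V : Type u} [Fintype V] (G : SimpleGraph V)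
    (hG : ∀ a b, G.Reachable a b)
    (hiso : ∀ a b, G.Adj a b → ∃ c, (G.Adj a c ∧ c ≠ b) ∨ (G.Adj b c ∧ c ≠ a)) :
    G.HasGoodPerturbation := by
  by_contra hno
  by_cases hedge : ∃ a b, G.Adj a b
  · obtain ⟨a₀, b₀, hab₀⟩ := hedge
    have hnbr : ∀ a, ∃ b, G.Adj a b := by
      intro a
      by_cases ha : a = a₀
      · exact ⟨b₀, ha ▸ hab₀⟩
      · obtain ⟨w⟩ := hG a a₀
        cases w with
        | nil => exact absurd rfl ha
        | cons h _ => exact ⟨_, h⟩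
    by_cases hleaf : ∃ l p, G.Adj l p ∧ ∀ w, G.Adj l w → w = p
    · obtain ⟨l, p, hlp, hl⟩ := hleaf
      obtain ⟨q, hq⟩ := hiso l p hlp
      have hq' : G.Adj p q ∧ q ≠ l := hq.resolve_left fun h => h.2 (hl q h.1)
      obtain ⟨B, hB, hpB, -, hc⟩ := exists_maximum_linked hG (fun B => p ∈ B)
        (fun B z h => Finset.mem_insert_of_mem h) (B₀ := {p})
        (by rw [Finset.coe_singleton]; exact isLinked_singleton G p) (by simp)
        (fun B h => ⟨p, h⟩)
      exact (isObstruction_of_not (r := p) hB.indep hc hno).false_of_leaf hc hpB hlp hl hq'.1 hq'.2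
    · push Not at hleaf
      have hdeg : ∀ a b, ∃ b', G.Adj a b' ∧ b' ≠ b := by
        intro a b
        obtain ⟨c, hc⟩ := hnbr a
        by_cases hcb : c = b
        · obtain ⟨d, hd, hdc⟩ := hleaf a c hc
          exact ⟨d, hd, hcb ▸ hdc⟩
        · exact ⟨c, hc, hcb⟩
      obtain ⟨B, hB, ⟨r, hr⟩, hmax, hc⟩ := exists_maximum_linked hG (fun B => B.Nonempty)
        (fun B z h => Finset.insert_nonempty _ _) (B₀ := {a₀})
        (by rw [Finset.coe_singleton]; exact isLinked_singleton G a₀) (by simp)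
        (fun B h => h)
      refine (isObstruction_of_not (r := r) hB.indep hc hno).false_of_maximum hc
        (fun B' hB' => ?_) hdeg hr
      rcases B'.eq_empty_or_nonempty with rfl | hne
      · simp
      · exact hmax B' hB' hne
  · push Not at hedge
    exact hno ⟨fun _ _ => 0, ⟨by simp, by simp, by simp⟩, fun u v huv => absurd huv (hedge u v)⟩

/-! ### From finite connected graphs to all graphs -/

theorem exists_weights_of_connected {W : Type u} [Fintype W] (G : SimpleGraph W)
    (hG : ∀ a b, G.Reachable a b)
    (hiso : ∀ a b, G.Adj a b → ∃ c, (G.Adj a c ∧ c ≠ b) ∨ (G.Adj b c ∧ c ≠ a)) :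
    ∃ w : W → W → ℕ, (∀ a b, w a b = w b a) ∧ (∀ a b, 1 ≤ w a b ∧ w a b ≤ 3) ∧
      ∀ u v, G.Adj u v → ∑ x with G.Adj u x, w u x ≠ ∑ x with G.Adj v x, w v x := by
  obtain ⟨ε, hε, hne⟩ := G.hasGoodPerturbation_of_connected hG hiso
  have hval : ∀ a b, ((2 + ε a b).toNat : ℤ) = 2 + ε a b := fun a b => by
    have := abs_le.1 (hε.le a b)
    omega
  refine ⟨fun a b => (2 + ε a b).toNat, fun a b => by simp only [hε.symm a b], fun a b => ?_,
    fun u v huv he => hne u v huv ?_⟩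
  · have := abs_le.1 (hε.le a b)
    have := hval a b
    dsimp only
    constructor <;> omega
  · have key : ∀ u, ((∑ x with G.Adj u x, (2 + ε u x).toNat : ℕ) : ℤ) =
        2 * G.intDegree u + ∑ b, ε u b := by
      intro u
      rw [Nat.cast_sum, Finset.sum_congr rfl fun x _ => hval u x, Finset.sum_filter, intDegree,
        Finset.mul_sum, ← Finset.sum_add_distrib]
      refine Finset.sum_congr rfl fun x _ => ?_
      by_cases h : G.Adj u x
      · simp [h]
      · simp [h, hε.supp u x h]
    rw [← key, ← key]
    exact_mod_cast he

/-- Graphs with finite components: the weightings of the components are put together. -/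
theorem exists_weights_of_finite_components {V : Type u} (H : SimpleGraph V)
    (hfin : ∀ C : H.ConnectedComponent, C.supp.Finite)
    (hiso : ∀ a b, H.Adj a b → ∃ c, (H.Adj a c ∧ c ≠ b) ∨ (H.Adj b c ∧ c ≠ a)) :
    ∃ w : V → V → ℕ, (∀ a b, w a b = w b a) ∧ (∀ a b, 1 ≤ w a b ∧ w a b ≤ 3) ∧
      ∀ u v, H.Adj u v → ∑ᶠ x : H.neighborSet u, w u x ≠ ∑ᶠ x : H.neighborSet v, w v x := by
  have hmem : ∀ (C : H.ConnectedComponent) {a b : V}, a ∈ C.supp → H.Adj a b → b ∈ C.supp :=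
    fun C a b ha hab => (ConnectedComponent.mem_supp_congr_adj C hab).1 ha
  have hcomp : ∀ C : H.ConnectedComponent, ∃ w : C.supp → C.supp → ℕ,
      (∀ a b, w a b = w b a) ∧ (∀ a b, 1 ≤ w a b ∧ w a b ≤ 3) ∧
      ∀ u v, (H.induce C.supp).Adj u v →
        ∑ᶠ x ∈ {x | (H.induce C.supp).Adj u x}, w u x ≠
          ∑ᶠ x ∈ {x | (H.induce C.supp).Adj v x}, w v x := by
    intro C
    have : Fintype C.supp := (hfin C).fintype
    obtain ⟨w, h1, h2, h3⟩ := exists_weights_of_connected (H.induce C.supp)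
      (fun a b => C.connected_toSimpleGraph.preconnected a b) (fun a b hab => by
        obtain ⟨c, hc⟩ := hiso a b hab
        have hcC : c ∈ C.supp := hc.elim (fun h => hmem C a.2 h.1) (fun h => hmem C b.2 h.1)
        exact ⟨⟨c, hcC⟩, hc.imp (fun h => ⟨h.1, fun e => h.2 (congrArg Subtype.val e)⟩)
          (fun h => ⟨h.1, fun e => h.2 (congrArg Subtype.val e)⟩)⟩)
    have key : ∀ u, ∑ᶠ x ∈ {x | (H.induce C.supp).Adj u x}, w u x =
        ∑ x with (H.induce C.supp).Adj u x, w u x := fun u => by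
      rw [← finsum_mem_coe_finset]
      simp
    exact ⟨w, h1, h2, fun u v huv => by rw [key, key]; exact h3 u v huv⟩
  choose w hw1 hw2 hw3 using hcomp
  let F : H.ConnectedComponent → V → V → ℕ := fun C a b =>
    if h : a ∈ C.supp ∧ b ∈ C.supp then w C ⟨a, h.1⟩ ⟨b, h.2⟩ else 1
  have hFs : ∀ C a b, F C a b = F C b a := fun C a b => by
    simp only [F]
    by_cases h : a ∈ C.supp ∧ b ∈ C.supp
    · rw [dif_pos h, dif_pos h.symm, hw1]
    · rw [dif_neg h, dif_neg fun h' => h h'.symm]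
  have hsum : ∀ (C : H.ConnectedComponent) (u : V) (hu : u ∈ C.supp),
      ∑ᶠ x : H.neighborSet u, F C u x =
        ∑ᶠ x ∈ {x | (H.induce C.supp).Adj ⟨u, hu⟩ x}, w C ⟨u, hu⟩ x := by
    intro C u hu
    have himg : H.neighborSet u = Subtype.val '' {x | (H.induce C.supp).Adj ⟨u, hu⟩ x} := by
      ext x
      constructor
      · intro hx
        exact ⟨⟨x, hmem C hu hx⟩, hx, rfl⟩
      · rintro ⟨y, hy, rfl⟩
        exact hy
    rw [finsum_set_coe_eq_finsum_mem (f := fun x => F C u x), himg,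
      finsum_mem_image Subtype.val_injective.injOn]
    refine finsum_mem_congr rfl fun x _ => ?_
    simp only [F]
    rw [dif_pos ⟨hu, x.2⟩]
  refine ⟨fun a b => if H.connectedComponentMk a = H.connectedComponentMk b then
      F (H.connectedComponentMk a) a b else 1, fun a b => ?_, fun a b => ?_, fun u v huv => ?_⟩
  · dsimp only
    by_cases h : H.connectedComponentMk a = H.connectedComponentMk b
    · rw [if_pos h, if_pos h.symm, hFs, h]
    · rw [if_neg h, if_neg fun h' => h h'.symm]
  · simp only [F]
    split_ifs
    exacts [hw2 _ _ _, ⟨le_rfl, by norm_num⟩, ⟨le_rfl, by norm_num⟩]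
  · have hC : ∀ {a b}, H.Adj a b → H.connectedComponentMk a = H.connectedComponentMk b :=
      fun hab => ConnectedComponent.sound hab.reachable
    have e : ∀ u, ∑ᶠ x : H.neighborSet u,
        (if H.connectedComponentMk u = H.connectedComponentMk x then
          F (H.connectedComponentMk u) u x else 1) =
        ∑ᶠ x : H.neighborSet u, F (H.connectedComponentMk u) u x := fun u =>
      finsum_congr fun x => if_pos (hC x.2)
    have hv : v ∈ (H.connectedComponentMk u).supp := (hC huv).symm
    rw [e, e, ← hC huv, hsum _ u rfl, hsum _ v hv]
    exact hw3 _ ⟨u, rfl⟩ ⟨v, hv⟩ huv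

/-- Finitely many constraints, each between two vertices of finite degree, can be satisfied: only
the edges that meet the finite set `X` of the vertices involved matter. -/
theorem exists_weights_of_finset {V : Type u} (G : SimpleGraph V)
    (hiso : ∀ a b, G.Adj a b → ∃ c, (G.Adj a c ∧ c ≠ b) ∨ (G.Adj b c ∧ c ≠ a))
    (t : Finset (Sym2 V)) :
    ∃ w : V → V → ℕ, (∀ a b, w a b = w b a) ∧ (∀ a b, 1 ≤ w a b ∧ w a b ≤ 3) ∧
      ∀ u v, G.Adj u v → s(u, v) ∈ t → (G.neighborSet u).Finite → (G.neighborSet v).Finite →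
        ∑ᶠ x : G.neighborSet u, w u x ≠ ∑ᶠ x : G.neighborSet v, w v x := by
  let X : Set V := {a | ∃ b, G.Adj a b ∧ s(a, b) ∈ t ∧ (G.neighborSet a).Finite ∧
    (G.neighborSet b).Finite}
  have hXfin : X.Finite := by
    have h1 : (⋃ e ∈ t, {a | a ∈ e}).Finite := by
      refine t.finite_toSet.biUnion fun e _ => ?_
      induction e with
      | _ a b => exact (Set.toFinite {a, b}).subset fun x hx => by simpa using hx
    refine h1.subset ?_
    rintro a ⟨b, -, hb, -⟩
    simp only [Set.mem_iUnion]
    exact ⟨_, hb, Sym2.mem_mk_left a b⟩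
  have hXN : ∀ a ∈ X, (G.neighborSet a).Finite := fun a ⟨_, _, _, h, _⟩ => h
  let H : SimpleGraph V :=
    { Adj := fun a b => G.Adj a b ∧ (a ∈ X ∨ b ∈ X)
      symm := ⟨fun _ _ h => ⟨h.1.symm, h.2.symm⟩⟩
      loopless := ⟨fun _ h => h.1.ne rfl⟩ }
  have hHN : ∀ a ∈ X, H.neighborSet a = G.neighborSet a := fun a ha => by
    ext b
    exact ⟨fun h => h.1, fun h => ⟨h, Or.inl ha⟩⟩
  let Y : Set V := X ∪ ⋃ a ∈ X, G.neighborSet a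
  have hY : Y.Finite := hXfin.union (hXfin.biUnion hXN)
  have hHY : ∀ a b, H.Adj a b → a ∈ Y := by
    rintro a b ⟨hab, ha | hb⟩
    · exact Or.inl ha
    · exact Or.inr (Set.mem_biUnion hb hab.symm)
  have hpartner : ∀ a ∈ X, ∃ b ∈ X, G.Adj a b := by
    rintro a ⟨b, h1, h2, h3, h4⟩
    exact ⟨b, ⟨a, h1.symm, by rwa [Sym2.eq_swap], h4, h3⟩, h1⟩
  have hHiso : ∀ a b, G.Adj a b → a ∈ X →
      ∃ c, (H.Adj a c ∧ c ≠ b) ∨ (H.Adj b c ∧ c ≠ a) := by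
    intro a b hab ha
    obtain ⟨u, hu, hau⟩ := hpartner a ha
    by_cases hub : u = b
    · subst hub
      obtain ⟨c, hc⟩ := hiso a u hab
      exact ⟨c, hc.imp (fun h => ⟨⟨h.1, Or.inl ha⟩, h.2⟩) fun h => ⟨⟨h.1, Or.inl hu⟩, h.2⟩⟩
    · exact ⟨u, Or.inl ⟨⟨hau, Or.inl ha⟩, hub⟩⟩
  obtain ⟨w, h1, h2, h3⟩ := exists_weights_of_finite_components H (fun C => by
      induction C using ConnectedComponent.ind with
      | _ v =>
        refine (hY.insert v).subset fun a ha => ?_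
        obtain ⟨p⟩ := ConnectedComponent.exact ha
        cases p with
        | nil => exact Set.mem_insert _ _
        | cons h _ => exact Set.mem_insert_of_mem _ (hHY _ _ h))
    (by
      rintro a b ⟨hab, ha | hb⟩
      · exact hHiso a b hab ha
      · obtain ⟨c, hc⟩ := hHiso b a hab.symm hb
        exact ⟨c, hc.symm⟩)
  refine ⟨w, h1, h2, fun u v huv ht hu hv => ?_⟩
  have huX : u ∈ X := ⟨v, huv, ht, hu, hv⟩
  have hvX : v ∈ X := ⟨u, huv.symm, by rwa [Sym2.eq_swap], hv, hu⟩
  have := h3 u v ⟨huv, Or.inl huX⟩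
  rwa [hHN u huX, hHN v hvX] at this

theorem weightedDegree_of_finite {V : Type u} (G : SimpleGraph V) (ω : G.edgeSet → ℕ) {v : V}
    (h : (G.neighborSet v).Finite) : G.weightedDegree ω v =
      ((∑ᶠ x : G.neighborSet v, ω ⟨s(v, x.1), G.mem_edgeSet.2 x.2⟩ : ℕ) : Cardinal.{u}) := by
  have : Fintype (G.neighborSet v) := h.fintype
  have h1 : ∀ n : ℕ, (n : Cardinal.{u}) = Cardinal.mk (ULift.{u} (Fin n)) := fun n => by simp
  simp only [weightedDegree, h1 (ω _)]
  rw [← Cardinal.mk_sigma, Cardinal.mk_fintype, Fintype.card_sigma, finsum_eq_sum_of_fintype]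
  simp

/-- At a vertex of infinite degree the weights do not matter. -/
theorem weightedDegree_of_infinite {V : Type u} (G : SimpleGraph V) {k : ℕ} {ω : G.edgeSet → ℕ}
    (hω : G.IsEdgeWeighting k ω) {v : V} (h : (G.neighborSet v).Infinite) :
    G.weightedDegree ω v = G.cardinalDegree v ∧ Cardinal.aleph0 ≤ G.cardinalDegree v := by
  have hinf : Cardinal.aleph0 ≤ G.cardinalDegree v := by
    have := h.to_subtype
    exact Cardinal.aleph0_le_mk _
  refine ⟨le_antisymm ?_ ?_, hinf⟩
  · calc G.weightedDegree ω v ≤ Cardinal.sum fun _ : G.neighborSet v => (k : Cardinal.{u}) :=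
        Cardinal.sum_le_sum _ _ fun x => by exact_mod_cast (hω _).2
      _ = G.cardinalDegree v * k := by rw [Cardinal.sum_const', cardinalDegree]
      _ ≤ G.cardinalDegree v * G.cardinalDegree v := by
          gcongr
          exact (Cardinal.natCast_lt_aleph0.le).trans hinf
      _ = G.cardinalDegree v := Cardinal.mul_eq_self hinf
  · calc G.cardinalDegree v = Cardinal.sum fun _ : G.neighborSet v => (1 : Cardinal.{u}) := by
          rw [Cardinal.sum_const', mul_one, cardinalDegree]
      _ ≤ G.weightedDegree ω v :=
        Cardinal.sum_le_sum _ _ fun x => by exact_mod_cast (hω _).1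

theorem exists_adj_of_not_isIsolatedEdge {V : Type u} {G : SimpleGraph V}
    (hG : ∀ e : Sym2 V, ¬ G.IsIsolatedEdge e) (a b : V) (hab : G.Adj a b) :
    ∃ c, (G.Adj a c ∧ c ≠ b) ∨ (G.Adj b c ∧ c ≠ a) := by
  by_contra hno
  push Not at hno
  refine hG s(a, b) ⟨hab, ?_⟩
  have key : ∀ x y, G.Adj x y → x ∈ s(a, b) → s(x, y) = s(a, b) := by
    intro x y hxy hx
    rcases Sym2.mem_iff.1 hx with rfl | rfl
    · rw [(hno y).1 hxy]
    · rw [(hno y).2 hxy, Sym2.eq_swap]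
  rintro f hf ⟨v, hv, hvf⟩
  obtain ⟨y, rfl⟩ := Sym2.mem_iff_exists.1 hvf
  exact key v y hf hv

end SimpleGraph

open SimpleGraph in
theorem theorem2 {V : Type u} (G : SimpleGraph V)
    (hG : ∀ e : Sym2 V, ¬ G.IsIsolatedEdge e) :
    ∃ ω : G.edgeSet → ℕ, G.IsWeighting 3 ω := by
  have hfinset := exists_weights_of_finset G (exists_adj_of_not_isIsolatedEdge hG)
  choose w hw1 hw2 hw3 using hfinset
  -- the weightings for the finite sets of edges are combined by compactness
  obtain ⟨χ, hχ⟩ := Finset.rado_selection (α := G.edgeSet) (β := fun _ => Set.Icc (1 : ℕ) 3)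
    fun t e => ⟨Sym2.lift ⟨w (t.map (Function.Embedding.subtype _)), hw1 _⟩ e.1, by
      obtain ⟨e, -⟩ := e
      induction e with
      | _ a b => exact hw2 _ a b⟩
  have hω : G.IsEdgeWeighting 3 fun e => (χ e : ℕ) := fun e => (χ e).2
  refine ⟨fun e => χ e, hω, fun u v huv => ?_⟩
  by_cases hu : (G.neighborSet u).Finite <;> by_cases hv : (G.neighborSet v).Finite
  · left
    rw [weightedDegree_of_finite G _ hu, weightedDegree_of_finite G _ hv, Ne, Nat.cast_inj]
    have := hu.to_subtype
    have := hv.to_subtype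
    let S : Set G.edgeSet :=
      Set.range (fun x : G.neighborSet u => (⟨s(u, x.1), G.mem_edgeSet.2 x.2⟩ : G.edgeSet)) ∪
      Set.range (fun x : G.neighborSet v => (⟨s(v, x.1), G.mem_edgeSet.2 x.2⟩ : G.edgeSet))
    have hS : S.Finite := (Set.finite_range _).union (Set.finite_range _)
    obtain ⟨t, hst, ht⟩ := hχ hS.toFinset
    have e1 : ∀ x : G.neighborSet u, ((χ ⟨s(u, x.1), G.mem_edgeSet.2 x.2⟩ : Set.Icc 1 3) : ℕ) =
        w (t.map (Function.Embedding.subtype _)) u x := fun x => by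
      rw [ht _ (hS.mem_toFinset.2 (Or.inl ⟨x, rfl⟩))]
      rfl
    have e2 : ∀ x : G.neighborSet v, ((χ ⟨s(v, x.1), G.mem_edgeSet.2 x.2⟩ : Set.Icc 1 3) : ℕ) =
        w (t.map (Function.Embedding.subtype _)) v x := fun x => by
      rw [ht _ (hS.mem_toFinset.2 (Or.inr ⟨x, rfl⟩))]
      rfl
    rw [finsum_congr e1, finsum_congr e2]
    refine hw3 _ u v huv ?_ hu hv
    rw [Finset.mem_map]
    exact ⟨⟨s(u, v), huv⟩, hst (hS.mem_toFinset.2 (Or.inl ⟨⟨v, huv⟩, rfl⟩)), rfl⟩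
  · left
    obtain ⟨e, hinf⟩ := weightedDegree_of_infinite G hω hv
    rw [weightedDegree_of_finite G _ hu, e]
    exact (Cardinal.natCast_lt_aleph0.trans_le hinf).ne
  · left
    obtain ⟨e, hinf⟩ := weightedDegree_of_infinite G hω hu
    rw [weightedDegree_of_finite G _ hv, e]
    exact (Cardinal.natCast_lt_aleph0.trans_le hinf).ne'
  · obtain ⟨e, hinf⟩ := weightedDegree_of_infinite G hω hu
    obtain ⟨e', -⟩ := weightedDegree_of_infinite G hω hv
    by_cases h : G.cardinalDegree u = G.cardinalDegree v
    · exact Or.inr ⟨h, hinf⟩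
    · left
      rwa [e, e']
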